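/- **Random graph.** Let $\beta>2$, $\lambda_{\mathrm{hub}},\lambda_{\mathrm{ldn}}\in(0,1)$, and for $n\to\infty$ let $m=m(n)>0$, $w=w(n)>0$, $\Delta=\Delta(n)\in\mathbb N_{\ge1}$, $\delta=\delta(n)\in\mathbb N$ satisfy $m\asymp n^{1/(\beta-1)}$, $w=o(n^{\lambda_{\mathrm{ldn}}/(\beta-1)})$, $\Delta\sim\lambda_{\mathrm{hub}}m$, $\delta\asymp m^{\lambda_{\mathrm{ldn}}}$. For $N\in\mathbb N$ let $G$ be a realization (almost every one) of the Chung–Lu random power-law graph on the nodes $1,\dots,N$: distinct nodes $i,j$ are linked independently with probability $\min\{1,w_iw_j/\sum_kw_k\}$, where, with $m=m(N)$, $w=w(N)$, $$w_i=\tfrac{\beta-2}{\beta-1}\,w\,N^{\frac1{\beta-1}}\Big[N\big(\tfrac{w(\beta-2)}{m(\beta-1)}\big)^{\beta-1}+i-1\Big]^{-\frac1{\beta-1}} .$$ Let $\Delta=\Delta(N)$, $\delta=\delta(N)$. Let $A$ be the adjacency matrix of $G$, $\mathcal N_i$ the set of neighbours and $k_i$ the degree of node $i$, $\Delta_0=\max_ik_i$,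 $\mathcal H_\Delta=\{i:k_i\ge\Delta\}$ the set of hubs, $M=\#\mathcal H_\Delta$, $\mathcal L_\delta=\{i:k_i\le\delta\}$ the set of low degree nodes, $\nu_i=\#(\mathcal N_i\cap\mathcal L_\delta)/k_i$. Suppose that $G$ is $(\Delta,\delta,\nu)$-locally star-like: $\nu_i\ge\nu$ for all $i\in\mathcal H_\Delta$. **Dynamics.** Let $\theta$ preserve the probability measure $\mathbb P$ on $\Omega$, $\mathbb T=\mathbb R/\mathbb Z$, and let $\varphi_i:\mathbb N\times\Omega\times\mathbb T\to\mathbb T$, $i=1,\dots,N$, be measurable cocycles over $\theta$. Assume: (R1) the random continuous maps $\varphi_i(1,\theta^t\omega,\cdot)$ are identically distributed and independent in $t\in\mathbb N$ and $i$; (R2) the isolated node dynamics have a unique stationary probability measure $m_0$, i.e. $\int\mathbb P(\varphi_i(1,\omega,x)\in B)\,dm_0(x)=m_0(B)$ for all Borel $B$; (R3) $h:\Omega\times\mathbb T^2\to\mathbb R$ is measurable, $h(\omega,\cdot,\cdot)\in C^4(\mathbb T^2;\mathbb R)$, and the $h(\theta^t\omega,\cdot,\cdot)$, $t\in\mathbb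 N$, are independent and identically distributed; and, for some $\lambda\in(0,1)$, $d_{\mathbb T}(\varphi_i(1,\omega,x),\varphi_i(1,\omega,y))\le\lambda\, d_{\mathbb T}(x,y)$ for all $i,\omega,x,y$. For $\alpha>0$ the network orbit of $(\omega,x)\in\Omega\times\mathbb T^N$ is $x^0=x$, $$x_i^{t+1}=\varphi_i(1,\theta^t\omega,x_i^t)+\frac{\alpha}{\Delta_0}\sum_{j}A_{ij}h(\theta^t\omega,x_i^t,x_j^t)\mod 1 .$$ For a hub $i$ put $\alpha_i=\alpha\nu_ik_i/\Delta_0$. The reduced system $\varphi_{\alpha_i,m_0}$ is $z^{t+1}=\varphi_i(1,\theta^t\omega,z^t)+\alpha_i\int h(\theta^t\omega,z^t,y)\,dm_0(y)\bmod 1$, and the fluctuation of hub $i$ about it is $\xi_i^t=\frac{\alpha}{\Delta_0}\sum_jA_{ij}h(\theta^t\omega,x_i^t,x_j^t)-\alpha_i\int h(\theta^t\omega,x_i^t,y)\,dm_0(y)$. Hub $i$ *admits $\eta$-reduction to $\varphi_{\alpha_i,m_0}$ with exceptional frequency at most $\rho$* if $\limsup_{T\to\infty}\frac1T\#\{0\le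 t<T:|\xi_i^t|>\eta\}\le\rho$. Write $\|h\|_{C^0}=\sup_t\|h(\theta^t\omega,\cdot,\cdot)\|_{C^0}$, $|h|_{\mathrm{Lip}}=\sup_t|h(\theta^t\omega,\cdot,\cdot)|_{\mathrm{Lip}}$ (for the maximum distance on $\mathbb T^2$), $\|h\|_{C^4}=\sup_t\|h(\theta^t\omega,\cdot,\cdot)\|_{C^4}$ (the largest sup norm of a partial derivative of order $\le4$). **Claim.** $m_0=\pi_*\mathbb P$ for the coding map $\pi(\omega)=\lim_n\varphi_i(1,\omega,\cdot)\circ\varphi_i(1,\theta\omega,\cdot)\circ\dots\circ\varphi_i(1,\theta^{n-1}\omega,p)$ of every node $i$. For $\mathbb P$-almost every $\omega$ with $\|h\|_{C^4}<\infty$ (otherwise the frequency bound below is infinite) and every $x\in\mathbb T^N$: 1. every low degree node $j$ is shadowed by its isolated orbit: $d_{\mathbb T}(x_j^t,\varphi_j(t,\omega,x_j))\le\frac{1}{1-\lambda}\,\alpha\Delta_0^{-1}\delta\,\|h\|_{C^0}$ for all $t\in\mathbb N$; 2. for every $$\varepsilon\ge\max\Big\{\alpha\Delta^{-1/2},\ 4\alpha^2\delta\Delta_0^{-1}(1-\lambda)^{-1}\|h\|_{C^0}|h|_{\mathrm{Lip}}\Big\}$$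 every hub $i\in\mathcal H_\Delta$ admits $(\varepsilon+\alpha(1-\nu)\|h\|_{C^0})$-reduction to $\varphi_{\alpha_i,m_0}$ with exceptional frequency at most $$4M\,D\,\exp\big(-\nu\Delta\,\varepsilon^2\alpha^{-2}c(\omega)\big),\qquad c(\omega)=\frac{450}{\|h\|_{C^4}^2},\qquad c_1\,\frac{\alpha\|h\|_{C^4}}{\varepsilon}\le D\le c_2\,\frac{\alpha\|h\|_{C^4}}{\varepsilon}.$$ Here $c_1,c_2>0$ are absolute constants and $D$ is a function of $\alpha$, $\varepsilon$ and $\|h\|_{C^4}$ only, so $D$ and $c$ do not depend on $N$, $G$ or $x$. (If $\|h\|_{C^4}=0$ then $D=0$ and the frequency is $0$.) -/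

import Mathlib

open MeasureTheory ProbabilityTheory Filter Topology Asymptotics

namespace HubReduction

noncomputable section

/-- The circle `ℝ / ℤ`, with its arc-length distance. -/
abbrev Circ := UnitAddCircle

/-! ### The Chung-Lu random power-law graph -/

/-- The power-law expected degree sequence with exponent `β`, `n` nodes, maximal expected degree `m`
and mean expected degree `w`.  The node called `i : Fin n` is the node number `i + 1` of `1, …, n`,
so the term `i - 1` of the usual formula reads `i` here. -/
def chungLuWeight (β : ℝ) (n : ℕ) (m w : ℝ) (i : Fin n) : ℝ :=
  (β - 2) / (β - 1) * w * (n : ℝ) ^ (1 / (β - 1)) *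
    ((n : ℝ) * (w * (β - 2) / (m * (β - 1))) ^ (β - 1) + ((i : ℕ) : ℝ)) ^ (-(1 / (β - 1)))

/-- The probability `w_i w_j / ∑ w_k` of a link between `i` and `j`, truncated to `[0, 1]`. -/
def linkProb (β : ℝ) (n : ℕ) (m w : ℝ) : Sym2 (Fin n) → unitInterval :=
  Sym2.lift ⟨fun i j => Set.projIcc (0 : ℝ) 1 zero_le_one
    (chungLuWeight β n m w i * chungLuWeight β n m w j / ∑ k, chungLuWeight β n m w k),
    fun i j => by
      beta_reduce
      rw [mul_comm (chungLuWeight β n m w i) (chungLuWeight β n m w j)]⟩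

/-- The law of the Chung-Lu random graph on `n` nodes: the links between distinct nodes are
independent, and `i`, `j` are linked with probability `linkProb` (loops are discarded). -/
def chungLuLaw (β : ℝ) (n : ℕ) (m w : ℝ) : Measure (SimpleGraph (Fin n)) :=
  (Measure.pi fun e : Sym2 (Fin n) => bernoulliMeasure True False (linkProb β n m w e)).map
    fun X => SimpleGraph.fromEdgeSet {e | X e}

instance (β : ℝ) (n : ℕ) (m w : ℝ) : IsProbabilityMeasure (chungLuLaw β n m w) := by
  unfold chungLuLaw
  refine Measure.isProbabilityMeasure_map (Measurable.aemeasurable ?_)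
  refine SimpleGraph.measurable_fromEdgeSet.comp (measurable_set_iff.2 fun e => ?_)
  exact measurable_pi_apply e

/-- The parameter regime of the locally star-like random power-law graph model, as the number `n` of
nodes grows: power-law exponent `β > 2`, maximal expected degree `m ≍ n ^ (1 / (β - 1))`, mean
expected degree `w = o(n ^ (lamLdn / (β - 1)))`, hub scale `Δ ∼ lamHub * m` and low degree scale
`δ ∼ cLdn * m ^ lamLdn` with `cLdn ≍ 1`, that is, `δ ≍ m ^ lamLdn`. -/
structure PowerLawRegime (β lamHub lamLdn : ℝ) (m w : ℕ → ℝ) (Δ δ : ℕ → ℕ) : Prop where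
  two_lt : 2 < β
  lamHub_mem : lamHub ∈ Set.Ioo (0 : ℝ) 1
  lamLdn_mem : lamLdn ∈ Set.Ioo (0 : ℝ) 1
  m_pos : ∀ n, 0 < m n
  w_pos : ∀ n, 0 < w n
  hubScale_pos : ∀ n, 0 < Δ n
  m_isTheta : m =Θ[atTop] fun n : ℕ => (n : ℝ) ^ (1 / (β - 1))
  w_isLittleO : w =o[atTop] fun n : ℕ => (n : ℝ) ^ (lamLdn / (β - 1))
  hubScale_equiv : (fun n => (Δ n : ℝ)) ~[atTop] fun n => lamHub * m n
  lowScale_isTheta : (fun n => (δ n : ℝ)) =Θ[atTop] fun n => m n ^ lamLdn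

/-! ### Locally star-like networks -/

section Graph

variable {N : ℕ}

open Classical in
/-- The degree `k_i` of node `i`. -/
def deg (G : SimpleGraph (Fin N)) (i : Fin N) : ℕ := G.degree i

open Classical in
/-- The largest degree `Δ₀`. -/
def largestDegree (G : SimpleGraph (Fin N)) : ℕ := G.maxDegree

open Classical in
/-- The hubs: the nodes of degree at least `Δ`. -/
def hubs (G : SimpleGraph (Fin N)) (Δ : ℕ) : Finset (Fin N) :=
  Finset.univ.filter fun i => Δ ≤ deg G i

open Classical in
/-- The low degree nodes: the nodes of degree at most `δ`. -/
def lowDegreeNodes (G : SimpleGraph (Fin N)) (δ : ℕ) : Finset (Fin N) :=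
  Finset.univ.filter fun i => deg G i ≤ δ

open Classical in
/-- The star-like index `ν_i` at node `i`: the proportion of low degree nodes among its
neighbours. -/
def starIndex (G : SimpleGraph (Fin N)) (δ : ℕ) (i : Fin N) : ℝ :=
  ((G.neighborFinset i ∩ lowDegreeNodes G δ).card : ℝ) / (deg G i : ℝ)

/-- `G` is a `(Δ, δ, ν)`-locally star-like network. -/
def IsLocallyStarLike (G : SimpleGraph (Fin N)) (Δ δ : ℕ) (ν : ℝ) : Prop :=
  ∀ i ∈ hubs G Δ, ν ≤ starIndex G δ i

end Graph

/-! ### Norms of coupling functions -/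

/-- The `C⁰` norm of `g : 𝕋² → ℝ`. -/
def normC0 (g : Circ → Circ → ℝ) : ℝ := ⨆ p : Circ × Circ, |g p.1 p.2|

/-- The Lipschitz seminorm of `g : 𝕋² → ℝ`, for the maximum distance on `𝕋²`. -/
def lipSeminorm (g : Circ → Circ → ℝ) : ℝ :=
  ⨆ q : (Circ × Circ) × (Circ × Circ), |g q.1.1 q.1.2 - g q.2.1 q.2.2| / dist q.1 q.2

/-- The partial derivative `∂₁^a ∂₂^b g` at the point with coordinates `s, u : ℝ`. -/
def partialDeriv (a b : ℕ) (g : Circ → Circ → ℝ) (s u : ℝ) : ℝ :=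
  iteratedDeriv a (fun s' : ℝ => iteratedDeriv b (fun u' : ℝ => g (s' : Circ) (u' : Circ)) u) s

/-- `g : 𝕋² → ℝ` is `C⁴`: its periodic lift to the plane is. -/
def IsC4 (g : Circ → Circ → ℝ) : Prop :=
  ContDiff ℝ 4 fun p : ℝ × ℝ => g (p.1 : Circ) (p.2 : Circ)

/-- The `C⁴` norm of `g : 𝕋² → ℝ`: the largest sup norm of a partial derivative of order at
most `4`. -/
def normC4 (g : Circ → Circ → ℝ) : ℝ :=
  ⨆ q : {ab : ℕ × ℕ // ab.1 + ab.2 ≤ 4} × (ℝ × ℝ),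
    |partialDeriv q.1.1.1 q.1.1.2 g q.2.1 q.2.2|

/-! ### Random node dynamics -/

section Dynamics

variable {Ω : Type*} {N : ℕ}

/-- `φ` is a (measurable) random dynamical system on the circle over `θ`. -/
structure IsRDS [MeasurableSpace Ω] (θ : Ω → Ω) (φ : ℕ → Ω → Circ → Circ) : Prop where
  measurable : Measurable fun q : ℕ × Ω × Circ => φ q.1 q.2.1 q.2.2
  zero : ∀ ω x, φ 0 ω x = x
  cocycle : ∀ s t ω x, φ (t + s) ω x = φ t (θ^[s] ω) (φ s ω x)

/-- The random maps `φ_i(1, θ^t ω, ·)` are continuous, have the same distribution and are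
independent in time `t` and node `i`.  The space `C(𝕋, 𝕋)` is seen inside `𝕋 → 𝕋` with the product
`σ`-algebra, whose trace on `C(𝕋, 𝕋)` is the Borel `σ`-algebra of uniform convergence. -/
structure IIDNodeMaps [MeasurableSpace Ω] (P : Measure Ω) (θ : Ω → Ω)
    (φ : Fin N → ℕ → Ω → Circ → Circ) : Prop where
  continuous : ∀ i ω, Continuous (φ i 1 ω)
  identDistrib : ∀ i j t s, IdentDistrib (fun ω => φ i 1 (θ^[t] ω)) (fun ω => φ j 1 (θ^[s] ω)) P P
  indep : iIndepFun (fun (p : ℕ × Fin N) ω => φ p.2 1 (θ^[p.1] ω)) P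

/-- `m` is a stationary measure of the iid iteration of the random map `f`:
`∫ P(x, B) dm(x) = m(B)` for the transition probability `P(x, B) = ℙ(f_ω(x) ∈ B)`. -/
def IsStationary [MeasurableSpace Ω] (P : Measure Ω) (f : Ω → Circ → Circ) (m : Measure Circ) :
    Prop :=
  ∀ B : Set Circ, MeasurableSet B → ∫⁻ x, P {ω | f ω x ∈ B} ∂m = m B

/-- `m` is the unique stationary probability measure of `f`. -/
def IsUniqueStationary [MeasurableSpace Ω] (P : Measure Ω) (f : Ω → Circ → Circ)
    (m : Measure Circ) : Prop :=
  IsProbabilityMeasure m ∧ IsStationary P f m ∧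
    ∀ m' : Measure Circ, IsProbabilityMeasure m' → IsStationary P f m' → m' = m

/-- The pre-composition `f_ω ∘ f_{θω} ∘ ⋯ ∘ f_{θ^{n-1}ω}`. -/
def precomp (θ : Ω → Ω) (f : Ω → Circ → Circ) : ℕ → Ω → Circ → Circ
  | 0, _, p => p
  | n + 1, ω, p => f ω (precomp θ f n (θ ω) p)

/-- The coding map `ω ↦ lim_n f_ω ∘ f_{θω} ∘ ⋯ ∘ f_{θ^{n-1}ω}(p)`, for uniform contractions `f_ω`;
the limit then exists and does not depend on `p`, and `p = 0` is taken here. -/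
def codingMap (θ : Ω → Ω) (f : Ω → Circ → Circ) (ω : Ω) : Circ :=
  limUnder atTop fun n => precomp θ f n ω 0

/-- The random coupling function `h` has values in `C⁴(𝕋²; ℝ)`, and `h(θ^t ω, ·, ·)`, `t ∈ ℕ`, have
the same distribution and are independent.  The space `C⁴(𝕋²; ℝ)` is seen inside `𝕋² → ℝ` with the
product `σ`-algebra, whose trace on `C⁴(𝕋²; ℝ)` is the Borel `σ`-algebra of the `C⁴` norm. -/
structure IIDCoupling [MeasurableSpace Ω] (P : Measure Ω) (θ : Ω → Ω)
    (h : Ω → Circ → Circ → ℝ) : Prop where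
  isC4 : ∀ ω, IsC4 (h ω)
  measurable : Measurable fun q : Ω × Circ × Circ => h q.1 q.2.1 q.2.2
  identDistrib : ∀ t s, IdentDistrib (fun ω (p : Circ × Circ) => h (θ^[t] ω) p.1 p.2)
    (fun ω (p : Circ × Circ) => h (θ^[s] ω) p.1 p.2) P P
  indep : iIndepFun (fun (t : ℕ) ω (p : Circ × Circ) => h (θ^[t] ω) p.1 p.2) P

/-! ### Network dynamics and reduction -/

open Classical in
/-- The total interaction `α / Δ₀ * ∑ j, A i j * h(ω, x i, x j)` felt by node `i`. -/
def interaction (G : SimpleGraph (Fin N)) (α : ℝ) (h : Ω → Circ → Circ → ℝ) (ω : Ω)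
    (x : Fin N → Circ) (i : Fin N) : ℝ :=
  α * (1 / (largestDegree G : ℝ)) * ∑ j, if G.Adj i j then h ω (x i) (x j) else 0

/-- The network dynamics `x^t = Φ_α(t, ω, x)`. -/
def networkOrbit (G : SimpleGraph (Fin N)) (α : ℝ) (θ : Ω → Ω) (φ : Fin N → ℕ → Ω → Circ → Circ)
    (h : Ω → Circ → Circ → ℝ) : ℕ → Ω → (Fin N → Circ) → Fin N → Circ
  | 0, _, x => x
  | t + 1, ω, x => fun i =>
      φ i 1 (θ^[t] ω) (networkOrbit G α θ φ h t ω x i) +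
        ((interaction G α h (θ^[t] ω) (networkOrbit G α θ φ h t ω x) i : ℝ) : Circ)

/-- The reduced one-dimensional system `φ_{a,m}` of a node with isolated dynamics `φ`. -/
def reducedSystem (θ : Ω → Ω) (φ : ℕ → Ω → Circ → Circ) (h : Ω → Circ → Circ → ℝ) (a : ℝ)
    (m : Measure Circ) : ℕ → Ω → Circ → Circ
  | 0, _, z => z
  | t + 1, ω, z =>
      φ 1 (θ^[t] ω) (reducedSystem θ φ h a m t ω z) +
        ((a * ∫ y, h (θ^[t] ω) (reducedSystem θ φ h a m t ω z) y ∂m : ℝ) : Circ)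

/-- The fluctuation `ξ` of node `i` about the reduced system `φ_{a,m}`. -/
def fluctuation (G : SimpleGraph (Fin N)) (α : ℝ) (h : Ω → Circ → Circ → ℝ) (a : ℝ)
    (m : Measure Circ) (i : Fin N) (ω : Ω) (x : Fin N → Circ) : ℝ :=
  interaction G α h ω x i - a * ∫ y, h ω (x i) y ∂m

/-- Node `i` evolves by the reduced system up to the fluctuation:
`x_i^{t+1} = φ_{a,m}(1, θ^t ω, x_i^t) + ξ(θ^t ω, x^t)`. -/
theorem networkOrbit_succ (G : SimpleGraph (Fin N)) (α : ℝ) (θ : Ω → Ω)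
    (φ : Fin N → ℕ → Ω → Circ → Circ) (h : Ω → Circ → Circ → ℝ) (a : ℝ) (m : Measure Circ)
    (i : Fin N) (t : ℕ) (ω : Ω) (x : Fin N → Circ) :
    networkOrbit G α θ φ h (t + 1) ω x i =
      reducedSystem θ (φ i) h a m 1 (θ^[t] ω) (networkOrbit G α θ φ h t ω x i) +
        ((fluctuation G α h a m i (θ^[t] ω) (networkOrbit G α θ φ h t ω x) : ℝ) : Circ) := by
  simp only [networkOrbit, reducedSystem, fluctuation, Function.iterate_zero, id, add_assoc,
    ← AddCircle.coe_add]
  congr 3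
  ring

open Classical in
/-- Node `i` admits `ε`-reduction to `φ_{a,m}` on the initial data `(ω, x)` with exceptional
frequency at most `ρ`: the upper asymptotic frequency of the times at which the fluctuation exceeds
`ε` in absolute value is at most `ρ`. -/
def AdmitsReduction (G : SimpleGraph (Fin N)) (α : ℝ) (θ : Ω → Ω)
    (φ : Fin N → ℕ → Ω → Circ → Circ) (h : Ω → Circ → Circ → ℝ) (a : ℝ) (m : Measure Circ)
    (i : Fin N) (ω : Ω) (x : Fin N → Circ) (ε ρ : ℝ) : Prop :=
  limsup (fun T : ℕ => (((Finset.range T).filter fun t =>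
      ε < |fluctuation G α h a m i (θ^[t] ω) (networkOrbit G α θ φ h t ω x)|).card : ℝ) / (T : ℝ))
    atTop ≤ ρ

/-- `sup_t ‖h(θ^t ω, ·, ·)‖_{C⁰}`. -/
def supC0 (θ : Ω → Ω) (h : Ω → Circ → Circ → ℝ) (ω : Ω) : ℝ := ⨆ t : ℕ, normC0 (h (θ^[t] ω))

/-- `sup_t |h(θ^t ω, ·, ·)|_{Lip}`. -/
def supLip (θ : Ω → Ω) (h : Ω → Circ → Circ → ℝ) (ω : Ω) : ℝ := ⨆ t : ℕ, lipSeminorm (h (θ^[t] ω))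

/-- `sup_t ‖h(θ^t ω, ·, ·)‖_{C⁴}`; a meaningful value only where the norms are bounded in `t`. -/
def supC4 (θ : Ω → Ω) (h : Ω → Circ → Circ → ℝ) (ω : Ω) : ℝ := ⨆ t : ℕ, normC4 (h (θ^[t] ω))

end Dynamics

end

end HubReduction

open HubReduction

/-!
A low degree node feels at most `α Δ₀⁻¹ δ ‖h‖` of interaction per step, so by contraction it
shadows its isolated orbit.  Replacing the orbits of the low degree neighbours of a hub by isolated
ones, its fluctuation is, up to that error and the `(1 - ν)`-fraction of other neighbours,
`α / Δ₀` times the deviation of the sum of `g = h(ω, x_i, ·)` over the neighbours from its mean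
under `m₀`.  The Fourier coefficients of a `C⁴` function decay like `|k|⁻⁴`, so it suffices to
control the deviations of the characters, and for these a threshold growing linearly in `|k|` is
affordable.

Contraction makes `φ_j(t, ω, x_j)` a function of the last `r` node maps up to an exponentially small
error, whatever the initial point.  These functions are independent over the nodes, hence
Hoeffding's inequality bounds the probability of a large deviation of some character.  The event has
finite range in time, so Birkhoff averages of its indicator along `θ` converge almost surely to its
probability, although `θ` is not assumed ergodic: along each residue class modulo a large `R` they
are averages of independent variables.  There are only countably many such events, so the
exceptional set of `ω` depends neither on `x` nor on `ε`.
-/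

namespace HubReduction

open scoped NNReal ENNReal

/-! ### Calculus on the circle -/

theorem exists_coe_eq_abs_eq_norm (x : Circ) : ∃ s : ℝ, (s : Circ) = x ∧ |s| = ‖x‖ := by
  obtain ⟨s, rfl⟩ := QuotientAddGroup.mk_surjective x
  refine ⟨s - round s, ?_, (UnitAddCircle.norm_eq).symm⟩
  have : ((round s : ℝ) : Circ) = 0 := (AddCircle.coe_eq_zero_iff 1).2 ⟨round s, by simp⟩
  rw [AddCircle.coe_sub, this, sub_zero]

theorem norm_sub_le_mul_dist_of_norm_deriv_le {E : Type*} [NormedAddCommGroup E] [NormedSpace ℝ E]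
    {f : Circ → E} {C : ℝ} (hf : Differentiable ℝ fun u : ℝ => f u)
    (hC : ∀ u : ℝ, ‖deriv (fun u : ℝ => f u) u‖ ≤ C) (x y : Circ) :
    ‖f x - f y‖ ≤ C * dist x y := by
  obtain ⟨s, rfl⟩ := QuotientAddGroup.mk_surjective y
  obtain ⟨r, hr, hr'⟩ := exists_coe_eq_abs_eq_norm (x - s)
  have hx : ((s + r : ℝ) : Circ) = x := by rw [AddCircle.coe_add, hr, add_sub_cancel]
  have h := Convex.norm_image_sub_le_of_norm_deriv_le (fun u _ => hf u) (fun u _ => hC u)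
    convex_univ (Set.mem_univ s) (Set.mem_univ (s + r))
  rwa [hx, add_sub_cancel_left, Real.norm_eq_abs, hr', ← dist_eq_norm x] at h

theorem periodic_comp_coe {X : Type*} (f : Circ → X) :
    Function.Periodic (fun u : ℝ => f u) 1 := fun u =>
  congrArg f (AddCircle.coe_add_period 1 u)

theorem continuous_of_continuous_comp_coe {X : Type*} [TopologicalSpace X] {f : Circ → X}
    (hf : Continuous fun u : ℝ => f u) : Continuous f :=
  QuotientAddGroup.isOpenQuotientMap_mk.isQuotientMap.continuous_iff.2 hf

theorem periodic_iteratedDeriv {𝕜 F : Type*} [NontriviallyNormedField 𝕜] [NormedAddCommGroup F]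
    [NormedSpace 𝕜 F] {f : 𝕜 → F} {c : 𝕜} (hf : Function.Periodic f c) (n : ℕ) :
    Function.Periodic (iteratedDeriv n f) c := fun x => by
  rw [← congrFun (iteratedDeriv_comp_add_const n f c) x, funext hf]

/-! ### Partial derivatives on the torus -/

theorem contDiff_iteratedDeriv_snd {E F : Type*} [NormedAddCommGroup E] [NormedSpace ℝ E]
    [NormedAddCommGroup F] [NormedSpace ℝ F] {m b : ℕ} {f : E × ℝ → F}
    (hf : ContDiff ℝ ((m + b : ℕ) : WithTop ℕ∞) f) :
    ContDiff ℝ m fun p : E × ℝ => iteratedDeriv b (fun u => f (p.1, u)) p.2 := by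
  induction b generalizing m with
  | zero => simpa using hf
  | succ b ih =>
    let K : E × ℝ → F := fun p => iteratedDeriv b (fun u => f (p.1, u)) p.2
    have hK : ContDiff ℝ ((m + 1 : ℕ) : WithTop ℕ∞) K := ih (by convert hf using 2; omega)
    have hderiv : (fun p : E × ℝ => iteratedDeriv (b + 1) (fun u => f (p.1, u)) p.2) =
        fun p => fderiv ℝ K p (0, 1) := by
      funext p
      rw [iteratedDeriv_succ]
      have hKp : HasFDerivAt K (fderiv ℝ K p) (p.1, p.2) :=
        (hK.differentiable (by simp) p).hasFDerivAt
      exact (hKp.comp_hasDerivAt p.2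
        ((hasDerivAt_const p.2 p.1).prodMk (hasDerivAt_id p.2))).deriv
    rw [hderiv]
    exact (hK.fderiv_right (by push_cast; exact le_rfl)).clm_apply contDiff_const

theorem exists_norm_le_of_periodic {E : Type*} [SeminormedAddCommGroup E] {f : ℝ × ℝ → E}
    (hf : Continuous f) (hleft : ∀ u, Function.Periodic (fun s => f (s, u)) 1)
    (hright : ∀ s, Function.Periodic (fun u => f (s, u)) 1) : ∃ C, ∀ p, ‖f p‖ ≤ C := by
  have hsquare : IsCompact (Set.Icc ((0, 0) : ℝ × ℝ) (1, 1)) := isCompact_Icc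
  obtain ⟨C, hC⟩ := hsquare.exists_bound_of_continuousOn hf.continuousOn
  refine ⟨C, fun p => ?_⟩
  obtain ⟨s, hs, hs'⟩ := (hleft p.2).exists_mem_Ico₀ one_pos p.1
  obtain ⟨u, hu, hu'⟩ := (hright s).exists_mem_Ico₀ one_pos p.2
  rw [show f p = f (s, u) from hs'.trans hu']
  exact hC (s, u) ⟨⟨hs.1, hu.1⟩, ⟨hs.2.le, hu.2.le⟩⟩

section PartialDeriv

variable {g : Circ → Circ → ℝ}

theorem IsC4.continuous_partialDeriv (hg : IsC4 g) {a b : ℕ} (hab : a + b ≤ 4) :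
    Continuous fun p : ℝ × ℝ => partialDeriv a b g p.1 p.2 := by
  have hsnd : ContDiff ℝ ((0 + a : ℕ) : WithTop ℕ∞) fun p : ℝ × ℝ =>
      iteratedDeriv b (fun u : ℝ => g p.1 u) p.2 :=
    contDiff_iteratedDeriv_snd (f := fun p : ℝ × ℝ => g p.1 p.2)
      (hg.of_le (by norm_cast; omega))
  have hfst := contDiff_iteratedDeriv_snd (hsnd.comp (contDiff_snd.prodMk contDiff_fst))
  exact hfst.continuous.comp (continuous_snd.prodMk continuous_fst)

theorem IsC4.exists_abs_partialDeriv_le (hg : IsC4 g) {a b : ℕ} (hab : a + b ≤ 4) :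
    ∃ C, ∀ s u, |partialDeriv a b g s u| ≤ C := by
  obtain ⟨C, hC⟩ := exists_norm_le_of_periodic (hg.continuous_partialDeriv hab)
    (fun u => periodic_iteratedDeriv
      (periodic_comp_coe fun x => iteratedDeriv b (fun u' : ℝ => g x u') u) a)
    (fun s => fun u => congrArg (iteratedDeriv a · s)
      (funext fun s' => periodic_iteratedDeriv (periodic_comp_coe (g s')) b u))
  exact ⟨C, fun s u => hC (s, u)⟩

theorem IsC4.abs_partialDeriv_le_normC4 (hg : IsC4 g) {a b : ℕ} (hab : a + b ≤ 4) (s u : ℝ) :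
    |partialDeriv a b g s u| ≤ normC4 g := by
  have : Finite {ab : ℕ × ℕ // ab.1 + ab.2 ≤ 4} :=
    ((Set.finite_Iic ((4, 4) : ℕ × ℕ)).subset fun ab (hab : ab.1 + ab.2 ≤ 4) =>
      ⟨(le_self_add).trans hab, (le_add_self).trans hab⟩).to_subtype
  choose C hC using fun ab : {ab : ℕ × ℕ // ab.1 + ab.2 ≤ 4} => hg.exists_abs_partialDeriv_le ab.2
  obtain ⟨B, hB⟩ := (Set.finite_range C).bddAbove
  refine le_ciSup (f := fun q : {ab : ℕ × ℕ // ab.1 + ab.2 ≤ 4} × (ℝ × ℝ) =>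
    |partialDeriv q.1.1.1 q.1.1.2 g q.2.1 q.2.2|) ⟨B, ?_⟩ (⟨(a, b), hab⟩, (s, u))
  rintro _ ⟨q, rfl⟩
  exact (hC q.1 q.2.1 q.2.2).trans (hB ⟨q.1, rfl⟩)

theorem IsC4.abs_le_normC4 (hg : IsC4 g) (x y : Circ) : |g x y| ≤ normC4 g := by
  obtain ⟨s, rfl⟩ := QuotientAddGroup.mk_surjective x
  obtain ⟨u, rfl⟩ := QuotientAddGroup.mk_surjective y
  simpa [partialDeriv] using hg.abs_partialDeriv_le_normC4 (a := 0) (b := 0) (by norm_num) s u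

theorem IsC4.abs_le_normC0 (hg : IsC4 g) (x y : Circ) : |g x y| ≤ normC0 g :=
  le_ciSup (f := fun p : Circ × Circ => |g p.1 p.2|)
    ⟨normC4 g, by rintro _ ⟨p, rfl⟩; exact hg.abs_le_normC4 p.1 p.2⟩ (x, y)

theorem IsC4.normC0_le_normC4 (hg : IsC4 g) : normC0 g ≤ normC4 g :=
  ciSup_le fun p => hg.abs_le_normC4 p.1 p.2

theorem IsC4.contDiff_left (hg : IsC4 g) (y : Circ) : ContDiff ℝ 4 fun s : ℝ => g s y := by
  obtain ⟨u, rfl⟩ := QuotientAddGroup.mk_surjective y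
  exact hg.comp (contDiff_id.prodMk contDiff_const)

theorem IsC4.contDiff_right (hg : IsC4 g) (x : Circ) : ContDiff ℝ 4 fun u : ℝ => g x u := by
  obtain ⟨s, rfl⟩ := QuotientAddGroup.mk_surjective x
  exact hg.comp (contDiff_const.prodMk contDiff_id)

theorem IsC4.abs_iteratedDeriv_left_le (hg : IsC4 g) {a : ℕ} (ha : a ≤ 4) (y : Circ) (s : ℝ) :
    |iteratedDeriv a (fun s : ℝ => g s y) s| ≤ normC4 g := by
  obtain ⟨u, rfl⟩ := QuotientAddGroup.mk_surjective y
  simpa only [partialDeriv, iteratedDeriv_zero] using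
    hg.abs_partialDeriv_le_normC4 (a := a) (b := 0) ha s u

theorem IsC4.abs_iteratedDeriv_right_le (hg : IsC4 g) {b : ℕ} (hb : b ≤ 4) (x : Circ) (u : ℝ) :
    |iteratedDeriv b (fun u : ℝ => g x u) u| ≤ normC4 g := by
  obtain ⟨s, rfl⟩ := QuotientAddGroup.mk_surjective x
  simpa only [partialDeriv, iteratedDeriv_zero] using
    hg.abs_partialDeriv_le_normC4 (a := 0) (b := b) (by simpa using hb) s u

theorem IsC4.abs_sub_le_two_mul_normC4_mul_dist (hg : IsC4 g) (p q : Circ × Circ) :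
    |g p.1 p.2 - g q.1 q.2| ≤ 2 * normC4 g * dist p q := by
  have hleft : |g p.1 p.2 - g q.1 p.2| ≤ normC4 g * dist p.1 q.1 :=
    norm_sub_le_mul_dist_of_norm_deriv_le (f := fun s => g s p.2)
      ((hg.contDiff_left p.2).differentiable (by norm_num)) (fun s => by
        simpa only [iteratedDeriv_one, Real.norm_eq_abs] using
          hg.abs_iteratedDeriv_left_le (a := 1) (by norm_num) p.2 s) p.1 q.1
  have hright : |g q.1 p.2 - g q.1 q.2| ≤ normC4 g * dist p.2 q.2 :=
    norm_sub_le_mul_dist_of_norm_deriv_le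
      ((hg.contDiff_right q.1).differentiable (by norm_num)) (fun u => by
        simpa only [iteratedDeriv_one, Real.norm_eq_abs] using
          hg.abs_iteratedDeriv_right_le (b := 1) (by norm_num) q.1 u) p.2 q.2
  have h₀ : 0 ≤ normC4 g := (abs_nonneg _).trans (hg.abs_le_normC4 0 0)
  calc |g p.1 p.2 - g q.1 q.2|
      ≤ |g p.1 p.2 - g q.1 p.2| + |g q.1 p.2 - g q.1 q.2| := abs_sub_le _ _ _
    _ ≤ normC4 g * dist p.1 q.1 + normC4 g * dist p.2 q.2 := add_le_add hleft hright
    _ ≤ normC4 g * dist p q + normC4 g * dist p q := by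
        gcongr
        exacts [le_max_left _ _, le_max_right _ _]
    _ = 2 * normC4 g * dist p q := by ring

theorem IsC4.abs_sub_div_dist_le (hg : IsC4 g) (p q : Circ × Circ) :
    |g p.1 p.2 - g q.1 q.2| / dist p q ≤ 2 * normC4 g :=
  div_le_of_le_mul₀ dist_nonneg
    (mul_nonneg zero_le_two ((abs_nonneg _).trans (hg.abs_le_normC4 0 0)))
    (hg.abs_sub_le_two_mul_normC4_mul_dist p q)

theorem IsC4.lipSeminorm_le (hg : IsC4 g) : lipSeminorm g ≤ 2 * normC4 g :=
  ciSup_le fun q => hg.abs_sub_div_dist_le q.1 q.2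

theorem IsC4.abs_sub_le_lipSeminorm_mul_dist (hg : IsC4 g) (x y y' : Circ) :
    |g x y - g x y'| ≤ lipSeminorm g * dist y y' := by
  rcases eq_or_ne y y' with rfl | hne
  · simp
  have hquot : |g x y - g x y'| / dist (x, y) (x, y') ≤ lipSeminorm g :=
    le_ciSup (f := fun q : (Circ × Circ) × (Circ × Circ) =>
        |g q.1.1 q.1.2 - g q.2.1 q.2.2| / dist q.1 q.2)
      ⟨2 * normC4 g, by rintro _ ⟨q, rfl⟩; exact hg.abs_sub_div_dist_le q.1 q.2⟩ ((x, y), (x, y'))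
  rw [Prod.dist_eq, dist_self, max_eq_right dist_nonneg] at hquot
  exact (div_le_iff₀ (dist_pos.2 hne)).1 hquot

end PartialDeriv

/-! ### Fourier coefficients of smooth functions on the circle -/

theorem norm_fourier_apply {T : ℝ} (k : ℤ) (x : AddCircle T) : ‖fourier k x‖ = 1 := by
  rw [fourier_apply, Circle.norm_coe]

theorem norm_fourier_sub_le (k : ℤ) (x y : Circ) :
    ‖fourier k x - fourier k y‖ ≤ 2 * Real.pi * |(k : ℝ)| * dist x y := by
  refine norm_sub_le_mul_dist_of_norm_deriv_le
    (fun u => (hasDerivAt_fourier (T := 1) k u).differentiableAt) (fun u => ?_) x y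
  rw [(hasDerivAt_fourier (T := 1) k u).deriv, norm_mul, norm_fourier_apply]
  simp [abs_of_pos Real.pi_pos]

theorem integrable_fourier (μ : Measure Circ) [IsFiniteMeasure μ] (k : ℤ) :
    Integrable (fun x => fourier k x) μ :=
  (map_continuous (fourier k)).integrable_of_hasCompactSupport
    (HasCompactSupport.of_compactSpace _)

theorem fourierCoeffOn_iteratedDeriv {F : ℝ → ℂ} {n : ℕ} (hF : ContDiff ℝ n F)
    (hper : Function.Periodic F 1) {k : ℤ} (hk : k ≠ 0) :
    fourierCoeffOn zero_lt_one (iteratedDeriv n F) k =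
      (2 * Real.pi * Complex.I * k) ^ n * fourierCoeffOn zero_lt_one F k := by
  induction n with
  | zero => simp
  | succ n ih =>
    have hderiv : ∀ x ∈ Set.uIcc (0 : ℝ) 1,
        HasDerivAt (iteratedDeriv n F) (iteratedDeriv (n + 1) F x) x := fun x _ => by
      rw [iteratedDeriv_succ]
      exact (hF.differentiable_iteratedDeriv n (by norm_cast; omega) x).hasDerivAt
    have hint : IntervalIntegrable (iteratedDeriv (n + 1) F) volume 0 1 :=
      (hF.continuous_iteratedDeriv (n + 1) le_rfl).intervalIntegrable _ _
    have hends : iteratedDeriv n F 1 - iteratedDeriv n F 0 = 0 := by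
      simpa [sub_eq_zero] using periodic_iteratedDeriv hper n 0
    have hparts := fourierCoeffOn_of_hasDerivAt zero_lt_one hk hderiv hint
    rw [ih (hF.of_le (by norm_cast; omega)), hends] at hparts
    rw [pow_succ', mul_assoc, hparts]
    have : (k : ℂ) ≠ 0 := by exact_mod_cast hk
    field_simp [Complex.I_ne_zero]
    simp

theorem norm_fourierCoeff_le {f : Circ → ℂ} {n : ℕ} {H : ℝ} (hf : ContDiff ℝ n fun u : ℝ => f u)
    (hH : ∀ u : ℝ, ‖iteratedDeriv n (fun u : ℝ => f u) u‖ ≤ H) {k : ℤ} (hk : k ≠ 0) :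
    ‖fourierCoeff f k‖ ≤ H / (2 * Real.pi * |(k : ℝ)|) ^ n := by
  have hcoeff : fourierCoeff f k = fourierCoeffOn zero_lt_one (fun u : ℝ => f u) k := by
    rw [fourierCoeff_eq_intervalIntegral _ _ 0, fourierCoeffOn_eq_integral]
    simp
  have hbound : ‖fourierCoeffOn zero_lt_one (iteratedDeriv n fun u : ℝ => f u) k‖ ≤ H := by
    rw [fourierCoeffOn_eq_integral]
    simp only [sub_zero, div_one, one_smul]
    refine (intervalIntegral.norm_integral_le_of_norm_le_const (C := H) fun x _ => ?_).trans
      (by simp)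
    rw [norm_smul, norm_fourier_apply, one_mul]
    exact hH x
  rw [fourierCoeffOn_iteratedDeriv hf (periodic_comp_coe f) hk, norm_mul, norm_pow] at hbound
  have : 0 < |(k : ℝ)| := by positivity
  rw [hcoeff, le_div_iff₀' (by positivity)]
  simpa [abs_of_pos Real.pi_pos] using hbound

theorem hasSum_one_div_int_sq : HasSum (fun k : ℤ => 1 / (k : ℝ) ^ 2) (Real.pi ^ 2 / 3) := by
  rw [show Real.pi ^ 2 / 3 = Real.pi ^ 2 / 6 + Real.pi ^ 2 / 6 - 1 / ((0 : ℤ) : ℝ) ^ 2 by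
    norm_num
    ring]
  exact HasSum.of_nat_of_neg (f := fun k : ℤ => 1 / (k : ℝ) ^ 2)
    (by simpa using hasSum_zeta_two) (by simpa using hasSum_zeta_two)

theorem summable_fourierCoeff {f : Circ → ℂ} {n : ℕ} (hn : 2 ≤ n)
    (hf : ContDiff ℝ n fun u : ℝ => f u) : Summable (fourierCoeff f) := by
  have hper : Function.Periodic (iteratedDeriv n fun u : ℝ => f u) 1 :=
    periodic_iteratedDeriv (periodic_comp_coe f) n
  obtain ⟨H, hH⟩ := (hper.compact_of_continuous one_ne_zero
    (hf.continuous_iteratedDeriv n le_rfl)).isBounded.exists_norm_le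
  refine Summable.of_norm_bounded_eventually
    (g := fun k : ℤ => H / (2 * Real.pi) ^ n * |1 / (k : ℝ) ^ n|)
    ((Real.summable_one_div_int_pow.2 (by omega)).abs.mul_left _) ?_
  filter_upwards [(Set.finite_singleton (0 : ℤ)).compl_mem_cofinite] with k hk
  refine (norm_fourierCoeff_le hf (fun u => hH _ (Set.mem_range_self u)) hk).trans_eq ?_
  rw [mul_pow, abs_div, abs_one, abs_pow]
  ring

theorem hasSum_fourierCoeff_mul_sum_sub_integral {ι : Type*} (S : Finset ι) (y : ι → Circ)
    (μ : Measure Circ) [IsFiniteMeasure μ] {f : Circ → ℂ} (hfc : Continuous f)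
    (hf : Summable (fourierCoeff f)) :
    HasSum (fun k => fourierCoeff f k * ∑ j ∈ S, (fourier k (y j) - ∫ z, fourier k z ∂μ))
      (∑ j ∈ S, (f (y j) - ∫ z, f z ∂μ)) := by
  have hseries (z : Circ) : HasSum (fun k => fourierCoeff f k * fourier k z) (f z) :=
    has_pointwise_sum_fourier_series_of_summable (f := ⟨f, hfc⟩) hf z
  have hint : HasSum (fun k => fourierCoeff f k * ∫ z, fourier k z ∂μ) (∫ z, f z ∂μ) := by
    have h := hasSum_integral_of_summable_integral_norm (μ := μ)
      (F := fun k z => fourierCoeff f k * fourier k z)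
      (fun k => (integrable_fourier μ k).const_mul _)
      (by simpa only [norm_mul, norm_fourier_apply, mul_one, integral_const, smul_eq_mul]
        using hf.norm.mul_left (μ.real Set.univ))
    simpa only [integral_const_mul, (hseries _).tsum_eq] using h
  simp only [Finset.mul_sum, mul_sub]
  exact hasSum_sum fun j _ => (hseries (y j)).sub hint

theorem norm_sum_sub_integral_le {ι : Type*} (S : Finset ι) (y : ι → Circ) (μ : Measure Circ)
    [IsProbabilityMeasure μ] {f : Circ → ℂ} {n : ℕ} {H τ : ℝ} (hn : 3 ≤ n)
    (hf : ContDiff ℝ n fun u : ℝ => f u)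
    (hH : ∀ u : ℝ, ‖iteratedDeriv n (fun u : ℝ => f u) u‖ ≤ H)
    (hτ : ∀ k : ℤ, k ≠ 0 →
      ‖∑ j ∈ S, (fourier k (y j) - ∫ z, fourier k z ∂μ)‖ ≤ τ * |(k : ℝ)|) :
    ‖∑ j ∈ S, (f (y j) - ∫ z, f z ∂μ)‖ ≤ H * τ / (2 * Real.pi) ^ n * (Real.pi ^ 2 / 3) := by
  have hH₀ : 0 ≤ H := (norm_nonneg _).trans (hH 0)
  have hτ₀ : 0 ≤ τ := by simpa using (norm_nonneg _).trans (hτ 1 one_ne_zero)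
  have hterm (k : ℤ) :
      ‖fourierCoeff f k * ∑ j ∈ S, (fourier k (y j) - ∫ z, fourier k z ∂μ)‖ ≤
        H * τ / (2 * Real.pi) ^ n * (1 / (k : ℝ) ^ 2) := by
    rcases eq_or_ne k 0 with rfl | hk
    · simp
    have hk₁ : (1 : ℝ) ≤ |(k : ℝ)| := by exact_mod_cast Int.one_le_abs hk
    have hpow : |(k : ℝ)| ^ 2 * |(k : ℝ)| ≤ |(k : ℝ)| ^ n := by
      rw [← pow_succ]
      exact pow_le_pow_right₀ hk₁ hn
    calc _ ≤ H / (2 * Real.pi * |(k : ℝ)|) ^ n * (τ * |(k : ℝ)|) := by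
          rw [norm_mul]
          exact mul_le_mul (norm_fourierCoeff_le hf hH hk) (hτ k hk) (norm_nonneg _) (by positivity)
      _ = H * τ / (2 * Real.pi) ^ n * (|(k : ℝ)| / |(k : ℝ)| ^ n) := by
          rw [mul_pow]
          ring
      _ ≤ H * τ / (2 * Real.pi) ^ n * (1 / |(k : ℝ)| ^ 2) := by
          refine mul_le_mul_of_nonneg_left ?_ (by positivity)
          rw [div_le_div_iff₀ (by positivity) (by positivity)]
          linarith
      _ = H * τ / (2 * Real.pi) ^ n * (1 / (k : ℝ) ^ 2) := by rw [sq_abs]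
  have hsum := hasSum_fourierCoeff_mul_sum_sub_integral S y μ
    (continuous_of_continuous_comp_coe hf.continuous) (summable_fourierCoeff (by omega) hf)
  rw [← hsum.tsum_eq]
  exact tsum_of_norm_bounded (hasSum_one_div_int_sq.mul_left _) hterm

theorem abs_sum_sub_integral_le {ι : Type*} (S : Finset ι) (y : ι → Circ) (μ : Measure Circ)
    [IsProbabilityMeasure μ] {f : Circ → ℝ} {H τ : ℝ} (hf : ContDiff ℝ 4 fun u : ℝ => f u)
    (hH : ∀ u : ℝ, |iteratedDeriv 4 (fun u : ℝ => f u) u| ≤ H)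
    (hτ : ∀ k : ℤ, k ≠ 0 →
      ‖∑ j ∈ S, (fourier k (y j) - ∫ z, fourier k z ∂μ)‖ ≤ τ * |(k : ℝ)|) :
    |∑ j ∈ S, (f (y j) - ∫ z, f z ∂μ)| ≤ H * τ / 400 := by
  have hH₀ : 0 ≤ H := (abs_nonneg _).trans (hH 0)
  have hτ₀ : 0 ≤ τ := by simpa using (norm_nonneg _).trans (hτ 1 one_ne_zero)
  have hderiv (u : ℝ) : ‖iteratedDeriv 4 (fun u : ℝ => (f u : ℂ)) u‖ ≤ H := by
    have h := Complex.ofRealLI.norm_iteratedFDeriv_comp_left hf.contDiffAt (x := u) le_rfl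
    rw [norm_iteratedFDeriv_eq_norm_iteratedDeriv, norm_iteratedFDeriv_eq_norm_iteratedDeriv] at h
    exact h.trans_le (hH u)
  have h := norm_sum_sub_integral_le S y μ (n := 4) (f := fun z => (f z : ℂ)) (by norm_num)
    (Complex.ofRealCLM.contDiff.comp hf) hderiv hτ
  rw [integral_complex_ofReal] at h
  calc |∑ j ∈ S, (f (y j) - ∫ z, f z ∂μ)|
      = ‖∑ j ∈ S, ((f (y j) : ℂ) - (∫ z, f z ∂μ : ℝ))‖ := by
        rw [← Real.norm_eq_abs, ← Complex.norm_real]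
        push_cast
        rfl
    _ ≤ H * τ / (2 * Real.pi) ^ 4 * (Real.pi ^ 2 / 3) := h
    _ = H * τ / (48 * Real.pi ^ 2) := by
        field_simp
        ring
    _ ≤ H * τ / 400 := by
        gcongr
        nlinarith [Real.pi_gt_three]

/-! ### Concentration of sums of characters -/

section Concentration

variable {Ω ι : Type*} [MeasurableSpace Ω] {P : Measure Ω} [IsProbabilityMeasure P]

theorem measureReal_le_abs_sum_sub_integral_le {X : ι → Ω → ℝ} (hind : iIndepFun X P)
    (hX : ∀ j, AEMeasurable (X j) P) {c : ℝ≥0} (hc : ∀ j ω, |X j ω| ≤ c) (S : Finset ι) {a : ℝ}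
    (ha : 0 ≤ a) :
    P.real {ω | a ≤ |∑ j ∈ S, (X j ω - ∫ ω', X j ω' ∂P)|} ≤
      2 * Real.exp (-(a ^ 2 / (2 * (S.card * c ^ 2)))) := by
  have hsub (j : ι) : HasSubgaussianMGF (fun ω => X j ω - ∫ ω', X j ω' ∂P) (c ^ 2) P := by
    have h := hasSubgaussianMGF_of_mem_Icc (hX j) (ae_of_all P fun ω => abs_le.1 (hc j ω))
    have hc' : (‖(c : ℝ) - -c‖₊ / 2) ^ 2 = c ^ 2 := by
      rw [sub_neg_eq_add, ← NNReal.coe_add, NNReal.nnnorm_eq, add_self_div_two]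
    rwa [hc'] at h
  have hind_sub : iIndepFun (fun j ω => X j ω - ∫ ω', X j ω' ∂P) P :=
    hind.comp (fun j v => v - ∫ ω', X j ω' ∂P) fun j => measurable_id.sub_const _
  have hupper := HasSubgaussianMGF.measure_sum_ge_le_of_iIndepFun hind_sub (s := S)
    (fun j _ => hsub j) ha
  have hlower := HasSubgaussianMGF.measure_sum_ge_le_of_iIndepFun
    (hind_sub.comp (fun _ v => -v) fun _ => measurable_neg) (s := S) (fun j _ => (hsub j).neg) ha
  have hvar : -a ^ 2 / (2 * ((∑ _j ∈ S, c ^ 2 : ℝ≥0) : ℝ)) = -(a ^ 2 / (2 * (S.card * c ^ 2))) := by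
    rw [neg_div]
    push_cast
    rw [Finset.sum_const, nsmul_eq_mul]
  rw [hvar] at hupper hlower
  have hsubset : {ω | a ≤ |∑ j ∈ S, (X j ω - ∫ ω', X j ω' ∂P)|} ⊆
      {ω | a ≤ ∑ j ∈ S, (X j ω - ∫ ω', X j ω' ∂P)} ∪
        {ω | a ≤ ∑ j ∈ S, -(X j ω - ∫ ω', X j ω' ∂P)} := fun ω hω => by
    simpa only [Set.mem_union, Set.mem_ofPred_eq, Finset.sum_neg_distrib] using le_abs.1 hω
  calc _ ≤ _ := (measureReal_mono hsubset).trans (measureReal_union_le _ _)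
    _ ≤ _ := add_le_add hupper hlower
    _ = _ := (two_mul _).symm

theorem measureReal_le_norm_sum_sub_integral_le {Z : ι → Ω → ℂ} (hind : iIndepFun Z P)
    (hZ : ∀ j, AEMeasurable (Z j) P) {c : ℝ≥0} (hc : ∀ j ω, ‖Z j ω‖ ≤ c) (S : Finset ι) {a : ℝ}
    (ha : 0 ≤ a) :
    P.real {ω | 2 * a ≤ ‖∑ j ∈ S, (Z j ω - ∫ ω', Z j ω' ∂P)‖} ≤
      4 * Real.exp (-(a ^ 2 / (2 * (S.card * c ^ 2)))) := by
  have hint (j : ι) : Integrable (Z j) P :=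
    .of_bound (hZ j).aestronglyMeasurable c (ae_of_all P (hc j))
  have hre := measureReal_le_abs_sum_sub_integral_le
    (hind.comp (fun _ => Complex.re) fun _ => Complex.measurable_re)
    (fun j => Complex.measurable_re.comp_aemeasurable (hZ j))
    (fun j ω => (Complex.abs_re_le_norm _).trans (hc j ω)) S ha
  have him := measureReal_le_abs_sum_sub_integral_le
    (hind.comp (fun _ => Complex.im) fun _ => Complex.measurable_im)
    (fun j => Complex.measurable_im.comp_aemeasurable (hZ j))
    (fun j ω => (Complex.abs_im_le_norm _).trans (hc j ω)) S ha
  have hsubset : {ω | 2 * a ≤ ‖∑ j ∈ S, (Z j ω - ∫ ω', Z j ω' ∂P)‖} ⊆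
      {ω | a ≤ |∑ j ∈ S, ((Complex.re ∘ Z j) ω - ∫ ω', (Complex.re ∘ Z j) ω' ∂P)|} ∪
        {ω | a ≤ |∑ j ∈ S, ((Complex.im ∘ Z j) ω - ∫ ω', (Complex.im ∘ Z j) ω' ∂P)|} := by
    intro ω hω
    have hre_int (j : ι) : ∫ ω', (Z j ω').re ∂P = (∫ ω', Z j ω' ∂P).re := integral_re (hint j)
    have him_int (j : ι) : ∫ ω', (Z j ω').im ∂P = (∫ ω', Z j ω' ∂P).im := integral_im (hint j)
    simp only [Set.mem_union, Set.mem_ofPred_eq, Function.comp_apply, hre_int, him_int,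
      ← Complex.sub_re, ← Complex.sub_im, ← Complex.re_sum, ← Complex.im_sum] at hω ⊢
    by_contra! h
    linarith [Complex.norm_le_abs_re_add_abs_im (∑ j ∈ S, (Z j ω - ∫ ω', Z j ω' ∂P))]
  calc _ ≤ _ := (measureReal_mono hsubset).trans (measureReal_union_le _ _)
    _ ≤ _ := add_le_add hre him
    _ = _ := by ring

/-- The event that some character `fourier k`, `k ≠ 0`, deviates on the sample `Y j`, `j ∈ S`, by
more than `2 q |k|` from its mean.  The threshold grows with `k` because the Fourier coefficients of
a `C⁴` function decay faster than is needed to sum the deviations. -/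
def characterDeviation (P : Measure Ω) (Y : ι → Ω → Circ) (S : Finset ι) (q : ℝ) : Set Ω :=
  {ω | ∃ k : ℤ, k ≠ 0 ∧
    2 * q * |(k : ℝ)| < ‖∑ j ∈ S, (fourier k (Y j ω) - ∫ ω', fourier k (Y j ω') ∂P)‖}

theorem norm_sum_fourier_sub_integral_le (Y : ι → Ω → Circ) (S : Finset ι) (k : ℤ) (ω : Ω) :
    ‖∑ j ∈ S, (fourier k (Y j ω) - ∫ ω', fourier k (Y j ω') ∂P)‖ ≤ 2 * S.card := by
  have hterm (j : ι) : ‖fourier k (Y j ω) - ∫ ω', fourier k (Y j ω') ∂P‖ ≤ 2 := by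
    have hmean : ‖∫ ω', fourier k (Y j ω') ∂P‖ ≤ 1 := by
      simpa using norm_integral_le_of_norm_le_const (μ := P)
        (ae_of_all P fun ω' => (norm_fourier_apply k (Y j ω')).le)
    linarith [norm_sub_le (fourier k (Y j ω)) (∫ ω', fourier k (Y j ω') ∂P),
      norm_fourier_apply k (Y j ω)]
  calc _ ≤ ∑ _j ∈ S, (2 : ℝ) := norm_sum_le_of_le S fun j _ => hterm j
    _ = 2 * S.card := by rw [Finset.sum_const, nsmul_eq_mul, mul_comm]

theorem measurableSet_characterDeviation {Ω : Type*} {m : MeasurableSpace Ω} [MeasurableSpace Ω]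
    (P : Measure Ω) {Y : ι → Ω → Circ} (hY : ∀ j, Measurable[m] (Y j)) (S : Finset ι) (q : ℝ) :
    MeasurableSet[m] (characterDeviation P Y S q) := by
  have hmeas : MeasurableSet {y : ι → Circ | ∃ k : ℤ, k ≠ 0 ∧
      2 * q * |(k : ℝ)| < ‖∑ j ∈ S, (fourier k (y j) - ∫ ω', fourier k (Y j ω') ∂P)‖} := by
    simp only [Set.ofPred_exists, Set.ofPred_and]
    exact .iUnion fun k => (MeasurableSet.const _).inter <| measurableSet_lt measurable_const <|
      (Finset.measurable_fun_sum S fun j _ =>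
        (((fourier k).continuous.measurable.comp (measurable_pi_apply j)).sub_const _)).norm
  exact @measurable_pi_lambda _ _ _ m _ (fun ω j => Y j ω) hY _ hmeas

theorem measureReal_characterDeviation_le {Y : ι → Ω → Circ} (hind : iIndepFun Y P)
    (hY : ∀ j, Measurable (Y j)) (S : Finset ι) {q : ℝ} (hq : 0 < q) :
    P.real (characterDeviation P Y S q) ≤
      8 * (S.card / q) * Real.exp (-(q ^ 2 / (2 * S.card))) := by
  let modes : Finset ℤ := (Finset.Icc (-⌊S.card / q⌋) ⌊S.card / q⌋).erase 0
  have hcard : (modes.card : ℝ) ≤ 2 * (S.card / q) := by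
    have hfloor : 0 ≤ ⌊S.card / q⌋ := Int.floor_nonneg.2 (by positivity)
    have hmodes : (modes.card : ℤ) = 2 * ⌊S.card / q⌋ := by
      rw [Finset.card_erase_of_mem (by simpa using hfloor), Int.card_Icc]
      omega
    have hmodes' : (modes.card : ℝ) = 2 * ⌊S.card / q⌋ := by exact_mod_cast hmodes
    rw [hmodes']
    gcongr
    exact Int.floor_le _
  have hsubset : characterDeviation P Y S q ⊆ ⋃ k ∈ modes,
      {ω | 2 * q ≤ ‖∑ j ∈ S, (fourier k (Y j ω) - ∫ ω', fourier k (Y j ω') ∂P)‖} := by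
    rintro ω ⟨k, hk, hω⟩
    have hk₁ : (1 : ℝ) ≤ |(k : ℝ)| := by exact_mod_cast Int.one_le_abs hk
    have hle : |(k : ℝ)| ≤ S.card / q := by
      rw [le_div_iff₀' hq]
      linarith [norm_sum_fourier_sub_integral_le (P := P) Y S k ω]
    have hmem : k ∈ modes := by
      rw [Finset.mem_erase, Finset.mem_Icc, ← abs_le, Int.le_floor, Int.cast_abs]
      exact ⟨hk, hle⟩
    exact Set.mem_biUnion hmem (le_trans (by nlinarith) hω.le)
  have hmode (k : ℤ) :
      P.real {ω | 2 * q ≤ ‖∑ j ∈ S, (fourier k (Y j ω) - ∫ ω', fourier k (Y j ω') ∂P)‖} ≤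
        4 * Real.exp (-(q ^ 2 / (2 * S.card))) := by
    simpa using measureReal_le_norm_sum_sub_integral_le (c := 1)
      (hind.comp (fun _ => fourier k) fun _ => (fourier k).continuous.measurable)
      (fun j => ((fourier k).continuous.measurable.comp (hY j)).aemeasurable)
      (fun j ω => (norm_fourier_apply k (Y j ω)).le) S hq.le
  calc P.real (characterDeviation P Y S q)
      ≤ ∑ k ∈ modes, 4 * Real.exp (-(q ^ 2 / (2 * S.card))) :=
        (measureReal_mono hsubset (measure_ne_top _ _)).trans <|
          (measureReal_biUnion_finset_le _ _).trans <| Finset.sum_le_sum fun k _ => hmode k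
    _ = modes.card * (4 * Real.exp (-(q ^ 2 / (2 * S.card)))) := by
        rw [Finset.sum_const, nsmul_eq_mul]
    _ ≤ 2 * (S.card / q) * (4 * Real.exp (-(q ^ 2 / (2 * S.card)))) := by gcongr
    _ = 8 * (S.card / q) * Real.exp (-(q ^ 2 / (2 * S.card))) := by ring

end Concentration

/-! ### Random maps and stationary measures -/

section GeneratedSigmaAlgebra

variable {Ω κ E : Type*} [MeasurableSpace E] {F : κ → Ω → E} {S T : Finset κ}

/-- The `σ`-algebra generated by the random variables `F p`, `p ∈ S`. -/
abbrev sigmaGenerated (F : κ → Ω → E) (S : Finset κ) : MeasurableSpace Ω :=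
  MeasurableSpace.comap (fun ω (p : S) => F p ω) MeasurableSpace.pi

theorem measurable_sigmaGenerated {p : κ} (hp : p ∈ S) : Measurable[sigmaGenerated F S] (F p) :=
  let _ := sigmaGenerated F S
  (measurable_pi_apply (⟨p, hp⟩ : S)).comp (comap_measurable fun ω (p : S) => F p ω)

theorem sigmaGenerated_le {m : MeasurableSpace Ω} (h : ∀ p ∈ S, Measurable[m] (F p)) :
    sigmaGenerated F S ≤ m :=
  (measurable_pi_iff.2 fun p : S => h p p.2).comap_le

theorem measurable_comp_of_sigmaGenerated {m : MeasurableSpace Ω} {T : Ω → Ω}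
    (hT : ∀ p ∈ S, Measurable[m] (F p ∘ T)) {E' : Type*} [MeasurableSpace E'] {g : Ω → E'}
    (hg : Measurable[sigmaGenerated F S] g) : Measurable[m] (g ∘ T) := fun _ hB =>
  sigmaGenerated_le (m := m.map T) hT _ (hg hB)

variable [MeasurableSpace Ω] {P : Measure Ω}

theorem indep_sigmaGenerated (hind : iIndepFun F P) (hF : ∀ p, Measurable (F p))
    (hST : Disjoint S T) : Indep (sigmaGenerated F S) (sigmaGenerated F T) P :=
  (IndepFun_iff_Indep _ _ _).1 (hind.indepFun_finset S T hST hF)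

theorem iIndep_sigmaGenerated [IsProbabilityMeasure P] {ι : Type*} (hind : iIndepFun F P)
    (hF : ∀ p, Measurable (F p)) {S : ι → Finset κ} (hS : Pairwise (Function.onFun Disjoint S)) :
    iIndep (fun j => sigmaGenerated F (S j)) P := by
  classical
  rw [iIndep_iff]
  intro J
  induction J using Finset.induction_on with
  | empty => simp
  | insert a J ha ih =>
    intro B hB
    have hdisj : Disjoint (S a) (J.biUnion S) :=
      (Finset.disjoint_biUnion_right _ _ _).2 fun j hj => hS (ne_of_mem_of_not_mem hj ha).symm
    have hle (j : ι) (hj : j ∈ J) : sigmaGenerated F (S j) ≤ sigmaGenerated F (J.biUnion S) :=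
      sigmaGenerated_le fun p hp => measurable_sigmaGenerated (Finset.mem_biUnion.2 ⟨j, hj, hp⟩)
    rw [Finset.set_biInter_insert, Finset.prod_insert ha,
      ← ih fun j hj => hB j (Finset.mem_insert_of_mem hj)]
    exact (Indep_iff _ _ _).1 (indep_sigmaGenerated hind hF hdisj) _ _
      (hB a (Finset.mem_insert_self _ _))
      (Finset.measurableSet_biInter (m := _) J fun j hj =>
        hle j hj _ (hB j (Finset.mem_insert_of_mem hj)))

end GeneratedSigmaAlgebra

section RandomMaps

variable {Ω : Type*}

theorem measurable_apply_of_continuous {_ : MeasurableSpace Ω} {f : Ω → Circ → Circ}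
    (hc : ∀ ω, Continuous (f ω)) (hf : Measurable f) {Z : Ω → Circ} (hZ : Measurable Z) :
    Measurable fun ω => f ω (Z ω) :=
  (measurable_uncurry_of_continuous_of_measurable (u := fun z ω => f ω z) hc
    (measurable_pi_iff.1 hf)).comp (hZ.prodMk measurable_id)

theorem measurable_precomp {m : MeasurableSpace Ω} {θ : Ω → Ω} {f : Ω → Circ → Circ}
    (hc : ∀ ω, Continuous (f ω)) {n : ℕ} (hf : ∀ t < n, Measurable fun ω => f (θ^[t] ω)) :
    Measurable (precomp θ f n) := by
  refine measurable_pi_iff.2 fun p => ?_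
  have hshift (n : ℕ) : ∀ s : ℕ, (∀ t < n, Measurable fun ω => f (θ^[t + s] ω)) →
      Measurable fun ω => precomp θ f n (θ^[s] ω) p := by
    induction n with
    | zero => exact fun s _ => measurable_const
    | succ n ih =>
      intro s hs
      have htail := ih (s + 1) fun t ht => by
        simpa only [add_right_comm, add_assoc] using hs (t + 1) (by omega)
      simp only [Function.iterate_succ_apply'] at htail
      exact measurable_apply_of_continuous (fun ω => hc _) (by simpa using hs 0 n.succ_pos) htail
  exact hshift n 0 hf

theorem precomp_succ_apply (θ : Ω → Ω) (f : Ω → Circ → Circ) (n : ℕ) (ω : Ω) (p : Circ) :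
    precomp θ f (n + 1) ω p = precomp θ f n ω (f (θ^[n] ω) p) := by
  induction n generalizing ω with
  | zero => rfl
  | succ n ih => rw [precomp, ih (θ ω)]; rfl

theorem continuous_precomp {θ : Ω → Ω} {f : Ω → Circ → Circ} (hc : ∀ ω, Continuous (f ω)) (n : ℕ)
    (ω : Ω) : Continuous (precomp θ f n ω) := by
  induction n generalizing ω with
  | zero => exact continuous_id
  | succ n ih => exact (hc ω).comp (ih (θ ω))

theorem lipschitzWith_precomp {θ : Ω → Ω} {f : Ω → Circ → Circ} {K : ℝ≥0}
    (hf : ∀ ω, LipschitzWith K (f ω)) (n : ℕ) (ω : Ω) :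
    LipschitzWith (K ^ n) (precomp θ f n ω) := by
  induction n generalizing ω with
  | zero => exact LipschitzWith.id
  | succ n ih =>
    rw [pow_succ']
    exact (hf ω).comp (ih (θ ω))

theorem dist_le_half (x y : Circ) : dist x y ≤ 1 / 2 := by
  rw [dist_eq_norm]
  simpa using AddCircle.norm_le_half_period (1 : ℝ) one_ne_zero (x := x - y)

theorem tendsto_precomp_codingMap {θ : Ω → Ω} {f : Ω → Circ → Circ} {K : ℝ≥0} (hK : K < 1)
    (hf : ∀ ω, LipschitzWith K (f ω)) (ω : Ω) (p : Circ) :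
    Tendsto (fun n => precomp θ f n ω p) atTop (𝓝 (codingMap θ f ω)) := by
  have hdist (n : ℕ) (x y : Circ) :
      dist (precomp θ f n ω x) (precomp θ f n ω y) ≤ 1 / 2 * (K : ℝ) ^ n := by
    rw [mul_comm]
    exact ((lipschitzWith_precomp hf n ω).dist_le_mul x y).trans <| by
      rw [NNReal.coe_pow]
      gcongr
      exact dist_le_half x y
  have hcauchy : CauchySeq fun n => precomp θ f n ω 0 :=
    cauchySeq_of_le_geometric K (1 / 2) hK fun n => by
      rw [precomp_succ_apply]
      exact hdist n _ _
  refine (tendsto_iff_of_dist ?_).1 (tendsto_nhds_limUnder (cauchySeq_tendsto_of_complete hcauchy))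
  refine squeeze_zero (fun _ => dist_nonneg) (fun n => hdist n _ _) ?_
  simpa using (tendsto_pow_atTop_nhds_zero_of_lt_one K.2 hK).const_mul (1 / 2 : ℝ)

theorem IsRDS.succ_apply [MeasurableSpace Ω] {θ : Ω → Ω} {φ : ℕ → Ω → Circ → Circ}
    (hφ : IsRDS θ φ) (t : ℕ) (ω : Ω) (x : Circ) : φ (t + 1) ω x = φ 1 (θ^[t] ω) (φ t ω x) := by
  rw [add_comm, hφ.cocycle]

theorem IsRDS.measurable_uncurry [MeasurableSpace Ω] {θ : Ω → Ω} {φ : ℕ → Ω → Circ → Circ}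
    (hφ : IsRDS θ φ) (t : ℕ) : Measurable (Function.uncurry (φ t)) :=
  hφ.measurable.comp measurable_prodMk_left

theorem IsRDS.measurable_map [MeasurableSpace Ω] {θ : Ω → Ω} {φ : ℕ → Ω → Circ → Circ}
    (hφ : IsRDS θ φ) (t : ℕ) : Measurable (φ t) :=
  measurable_pi_iff.2 fun _ => (hφ.measurable_uncurry t).comp measurable_prodMk_right

theorem IsRDS.measurable_of_measurable_maps {m : MeasurableSpace Ω} [MeasurableSpace Ω]
    {θ : Ω → Ω} {φ : ℕ → Ω → Circ → Circ} (hφ : IsRDS θ φ) (hc : ∀ ω, Continuous (φ 1 ω)) {r : ℕ}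
    (hm : ∀ t < r, Measurable[m] fun ω => φ 1 (θ^[t] ω)) (x : Circ) :
    Measurable[m] fun ω => φ r ω x := by
  induction r with
  | zero =>
    simp only [hφ.zero]
    exact measurable_const
  | succ r ih =>
    simp only [fun ω => hφ.succ_apply r ω x]
    exact measurable_apply_of_continuous (fun ω => hc _) (hm r r.lt_succ_self)
      (ih fun t ht => hm t (ht.trans r.lt_succ_self))

theorem IsRDS.lipschitzWith [MeasurableSpace Ω] {θ : Ω → Ω} {φ : ℕ → Ω → Circ → Circ}
    (hφ : IsRDS θ φ) {K : ℝ≥0} (hK : ∀ ω, LipschitzWith K (φ 1 ω)) (t : ℕ) (ω : Ω) :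
    LipschitzWith (K ^ t) (φ t ω) := by
  induction t with
  | zero =>
    rw [funext (hφ.zero ω)]
    exact LipschitzWith.id
  | succ t ih =>
    rw [pow_succ', funext (hφ.succ_apply t ω)]
    exact (hK _).comp ih

end RandomMaps

section Stationary

variable {Ω : Type*} [MeasurableSpace Ω] {P : Measure Ω} [IsProbabilityMeasure P] {θ : Ω → Ω}
  {m : Measure Circ} {f g : Ω → Circ → Circ}

theorem measure_mem_of_indepFun {X Y : Type*} [MeasurableSpace X] [MeasurableSpace Y] {Z : Ω → X}
    {W : Ω → Y} (hZ : Measurable Z) (hW : Measurable W) (hind : IndepFun Z W P) {s : Set (X × Y)}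
    (hs : MeasurableSet s) :
    P {ω | (Z ω, W ω) ∈ s} = ∫⁻ ω, P {ω' | (Z ω, W ω') ∈ s} ∂P := by
  have hslice (z : X) : P.map W (Prod.mk z ⁻¹' s) = P {ω' | (z, W ω') ∈ s} :=
    Measure.map_apply hW (measurable_prodMk_left hs)
  calc P {ω | (Z ω, W ω) ∈ s} = P.map (fun ω => (Z ω, W ω)) s :=
        (Measure.map_apply (hZ.prodMk hW) hs).symm
    _ = ∫⁻ z, P.map W (Prod.mk z ⁻¹' s) ∂(P.map Z) := by
        rw [hind.map_prod_eq_prod_map_map hZ.aemeasurable hW.aemeasurable, Measure.prod_apply hs]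
    _ = ∫⁻ ω, P {ω' | (Z ω, W ω') ∈ s} ∂P := by
        rw [lintegral_map (measurable_measure_prodMk_left hs) hZ]
        simp only [hslice]

theorem measure_apply_mem_of_indepFun {Z : Ω → Circ} (hZ : Measurable Z) (hg : Measurable g)
    (hc : ∀ ω, Continuous (g ω)) (hind : IndepFun Z g P) {B : Set Circ} (hB : MeasurableSet B) :
    P {ω | g ω (Z ω) ∈ B} = ∫⁻ ω, P {ω' | g ω' (Z ω) ∈ B} ∂P := by
  -- Evaluation `𝕋 × 𝕋^𝕋 → 𝕋` is not jointly measurable, so `g` cannot serve as the second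
  -- variable; the identity of `Ω`, with the `σ`-algebra of `g`, can.
  have heval : Measurable[MeasurableSpace.prod inferInstance (MeasurableSpace.pi.comap g)]
      fun q : Circ × Ω => g q.2 q.1 :=
    measurable_uncurry_of_continuous_of_measurable (m := MeasurableSpace.pi.comap g)
      (u := fun z ω => g ω z) hc
      fun z => (measurable_pi_apply z).comp (comap_measurable g)
  have hind_id : @IndepFun _ _ _ _ _ (MeasurableSpace.pi.comap g) Z id P := by
    rw [@IndepFun_iff_Indep _ _ _ _ _ (MeasurableSpace.pi.comap g), MeasurableSpace.comap_id]
    exact (IndepFun_iff_Indep _ _ _).1 hind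
  exact @measure_mem_of_indepFun _ _ _ _ _ _ _ (MeasurableSpace.pi.comap g) _ _ hZ
    (measurable_id'' hg.comap_le) hind_id _ (heval hB)

omit [IsProbabilityMeasure P] in
theorem IsStationary.comp_measurePreserving {T : Ω → Ω} (hm : IsStationary P f m)
    (hT : MeasurePreserving T P P) (hf : Measurable f) : IsStationary P (fun ω => f (T ω)) m := by
  intro B hB
  rw [← hm B hB]
  exact lintegral_congr fun x => hT.measure_preimage
    (measurable_pi_iff.1 hf x hB).nullMeasurableSet

theorem IsStationary.map_prod [SFinite m] (hm : IsStationary P f m)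
    (hf : Measurable (Function.uncurry f)) : (m.prod P).map (fun q => f q.2 q.1) = m := by
  have hf' : Measurable fun q : Circ × Ω => f q.2 q.1 := hf.comp measurable_swap
  ext B hB
  rw [Measure.map_apply hf' hB, Measure.prod_apply (hf' hB), ← hm B hB]
  rfl

theorem IsStationary.comp [SFinite m] (hfm : IsStationary P f m) (hgm : IsStationary P g m)
    (hf : Measurable (Function.uncurry f)) (hg : Measurable g) (hgc : ∀ ω, Continuous (g ω))
    (hind : ∀ x, IndepFun (fun ω => f ω x) g P) :
    IsStationary P (fun ω x => g ω (f ω x)) m := by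
  intro B hB
  have hu : Measurable fun z => P {ω | g ω z ∈ B} :=
    measurable_measure_prodMk_left (ν := P) <|
      measurable_uncurry_of_continuous_of_measurable (u := fun z ω => g ω z) hgc
        (measurable_pi_iff.1 hg) hB
  calc ∫⁻ x, P {ω | g ω (f ω x) ∈ B} ∂m = ∫⁻ x, ∫⁻ ω, P {ω' | g ω' (f ω x) ∈ B} ∂P ∂m :=
        lintegral_congr fun x => measure_apply_mem_of_indepFun
          (hf.comp measurable_prodMk_right) hg hgc (hind x) hB
    _ = ∫⁻ q, P {ω' | g ω' (f q.2 q.1) ∈ B} ∂(m.prod P) :=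
        (lintegral_prod _ (hu.comp (hf.comp measurable_swap)).aemeasurable).symm
    _ = ∫⁻ z, P {ω' | g ω' z ∈ B} ∂m := by
        conv_rhs => rw [← hfm.map_prod hf]
        exact (lintegral_map hu (hf.comp measurable_swap)).symm
    _ = m B := hgm B hB

theorem isStationary_id {Ω : Type*} [MeasurableSpace Ω] (P : Measure Ω) [IsProbabilityMeasure P]
    (m : Measure Circ) : IsStationary P (fun _ x => x) m := by
  intro B hB
  rw [← lintegral_indicator_one hB]
  refine lintegral_congr fun x => ?_
  by_cases hx : x ∈ B <;> simp [hx]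

theorem IsRDS.isStationary [SFinite m] {φ : ℕ → Ω → Circ → Circ} (hφ : IsRDS θ φ)
    (hθ : MeasurePreserving θ P P) (hc : ∀ ω, Continuous (φ 1 ω))
    (hind : iIndepFun (fun (t : ℕ) ω => φ 1 (θ^[t] ω)) P) (hm : IsStationary P (φ 1) m) (r : ℕ) :
    IsStationary P (φ r) m := by
  have hmaps (t : ℕ) : Measurable fun ω => φ 1 (θ^[t] ω) :=
    (hφ.measurable_map 1).comp (hθ.measurable.iterate t)
  induction r with
  | zero =>
    rw [funext fun ω => funext (hφ.zero ω)]
    exact isStationary_id P m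
  | succ r ih =>
    rw [funext fun ω => funext (hφ.succ_apply r ω)]
    refine ih.comp (hm.comp_measurePreserving (hθ.iterate r) (hφ.measurable_map 1))
      (hφ.measurable_uncurry r) (hmaps r) (fun ω => hc _) fun x => ?_
    exact indep_of_indep_of_le_right (indep_of_indep_of_le_left
      (indep_sigmaGenerated hind hmaps (S := .range r) (T := {r}) (by simp))
      (hφ.measurable_of_measurable_maps hc (fun t ht =>
        measurable_sigmaGenerated (F := fun (t : ℕ) ω => φ 1 (θ^[t] ω)) (by simpa using ht))
        x).comap_le)
      (measurable_sigmaGenerated (F := fun (t : ℕ) ω => φ 1 (θ^[t] ω)) (by simp)).comap_le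

theorem isStationary_precomp [SFinite m] (hθ : MeasurePreserving θ P P)
    (hf : Measurable (Function.uncurry f)) (hc : ∀ ω, Continuous (f ω))
    (hind : iIndepFun (fun (t : ℕ) ω => f (θ^[t] ω)) P) (hm : IsStationary P f m) (n : ℕ) :
    IsStationary P (precomp θ f n) m := by
  have hf' : Measurable f := measurable_pi_iff.2 fun _ => hf.comp measurable_prodMk_right
  have hmaps (t : ℕ) : Measurable fun ω => f (θ^[t] ω) := hf'.comp (hθ.measurable.iterate t)
  induction n with
  | zero => exact isStationary_id P m
  | succ n ih =>
    rw [funext fun ω => funext (precomp_succ_apply θ f n ω)]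
    refine (hm.comp_measurePreserving (hθ.iterate n) hf').comp ih
      (hf.comp ((hθ.measurable.iterate n).prodMap measurable_id))
      (measurable_precomp hc fun t _ => hmaps t)
      (continuous_precomp hc n) fun x => ?_
    exact indep_of_indep_of_le_right (indep_of_indep_of_le_left
      (indep_sigmaGenerated hind hmaps (S := {n}) (T := .range n) (by simp))
      ((measurable_pi_apply x).comp
        (measurable_sigmaGenerated (F := fun (t : ℕ) ω => f (θ^[t] ω)) (by simp))).comap_le)
      (measurable_precomp hc fun t ht =>
        measurable_sigmaGenerated (F := fun (t : ℕ) ω => f (θ^[t] ω)) (by simpa using ht)).comap_le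

theorem IsStationary.integral_comp [SFinite m] {E : Type*} [NormedAddCommGroup E]
    [NormedSpace ℝ E] (hm : IsStationary P f m) (hf : Measurable (Function.uncurry f))
    {ψ : Circ → E} (hψ : AEStronglyMeasurable ψ m) :
    ∫ q, ψ (f q.2 q.1) ∂(m.prod P) = ∫ x, ψ x ∂m := by
  have hf' : AEMeasurable (fun q : Circ × Ω => f q.2 q.1) (m.prod P) :=
    (hf.comp measurable_swap).aemeasurable
  rw [← integral_map hf' (by rwa [hm.map_prod hf]), hm.map_prod hf]

theorem IsStationary.norm_integral_sub_integral_le [IsProbabilityMeasure m]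
    (hm : IsStationary P f m) (hf : Measurable (Function.uncurry f)) {ψ : Circ → ℂ}
    (hψ : Continuous ψ) (p : Circ) {C : ℝ} (hC : ∀ ω x, ‖ψ (f ω p) - ψ (f ω x)‖ ≤ C) :
    ‖∫ ω, ψ (f ω p) ∂P - ∫ x, ψ x ∂m‖ ≤ C := by
  obtain ⟨M, hM⟩ := isCompact_univ.exists_bound_of_continuousOn hψ.continuousOn
  have hint {g : Circ × Ω → Circ} (hg : Measurable g) :
      Integrable (fun q => ψ (g q)) (m.prod P) :=
    .of_bound (hψ.measurable.comp hg).aestronglyMeasurable M (ae_of_all _ fun q => hM _ trivial)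
  have hfp : Measurable fun ω => f ω p := hf.comp measurable_prodMk_right
  have hconst : ∫ q, ψ (f q.2 p) ∂(m.prod P) = ∫ ω, ψ (f ω p) ∂P := by
    rw [integral_fun_snd fun ω => ψ (f ω p), probReal_univ, one_smul]
  rw [← hm.integral_comp hf hψ.aestronglyMeasurable, ← hconst,
    ← integral_sub (hint (g := fun q => f q.2 p) (hfp.comp measurable_snd))
      (hint (g := fun q => f q.2 q.1) (hf.comp measurable_swap))]
  simpa using norm_integral_le_of_norm_le_const (μ := m.prod P)
    (ae_of_all _ fun q : Circ × Ω => hC q.2 q.1)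

theorem IsStationary.eq_map_codingMap [IsProbabilityMeasure m] (hθ : MeasurePreserving θ P P)
    (hf : Measurable (Function.uncurry f)) {K : ℝ≥0} (hK : K < 1)
    (hlip : ∀ ω, LipschitzWith K (f ω))
    (hind : iIndepFun (fun (t : ℕ) ω => f (θ^[t] ω)) P) (hm : IsStationary P f m) :
    m = P.map (codingMap θ f) := by
  have hc (ω : Ω) : Continuous (f ω) := (hlip ω).continuous
  have hf' : Measurable f := measurable_pi_iff.2 fun _ => hf.comp measurable_prodMk_right
  have hpre (n : ℕ) (p : Circ) : Measurable fun ω => precomp θ f n ω p :=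
    measurable_pi_iff.1 (measurable_precomp hc fun t _ => hf'.comp (hθ.measurable.iterate t)) p
  have hpre_uncurry (n : ℕ) : Measurable (Function.uncurry (precomp θ f n)) :=
    (measurable_uncurry_of_continuous_of_measurable (u := fun p ω => precomp θ f n ω p)
      (continuous_precomp hc n) (hpre n)).comp measurable_swap
  have hcoding : Measurable (codingMap θ f) :=
    measurable_of_tendsto_metrizable (fun n => hpre n 0) <|
      tendsto_pi_nhds.2 fun ω => tendsto_precomp_codingMap hK hlip ω 0
  have := Measure.isProbabilityMeasure_map (μ := P) hcoding.aemeasurable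
  refine ext_of_forall_integral_eq_of_IsFiniteMeasure fun ψ => ?_
  have hlim : Tendsto (fun n => ∫ q, ψ (precomp θ f n q.2 q.1) ∂(m.prod P)) atTop
      (𝓝 (∫ q, ψ (codingMap θ f q.2) ∂(m.prod P))) :=
    tendsto_integral_of_dominated_convergence (fun _ => ‖ψ‖)
      (fun n => (ψ.continuous.measurable.comp
        ((hpre_uncurry n).comp measurable_swap)).aestronglyMeasurable)
      (integrable_const _) (fun n => ae_of_all _ fun q => ψ.norm_coe_le_norm _)
      (ae_of_all _ fun q => (ψ.continuous.tendsto _).comp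
        (tendsto_precomp_codingMap hK hlip q.2 q.1))
  simp only [fun n => (isStationary_precomp hθ hf hc hind hm n).integral_comp (hpre_uncurry n)
    ψ.continuous.aestronglyMeasurable] at hlim
  rw [integral_map hcoding.aemeasurable ψ.continuous.aestronglyMeasurable,
    tendsto_nhds_unique tendsto_const_nhds hlim,
    integral_fun_snd (μ := m) (fun ω => ψ (codingMap θ f ω)), probReal_univ, one_smul]

end Stationary

/-! ### Frequencies of events of finite range -/

section Frequencies

theorem tendsto_add_div_div_atTop (c : ℕ) {R : ℕ} (hcR : c < R) :
    Tendsto (fun T : ℕ => (((T + c) / R : ℕ) : ℝ) / T) atTop (𝓝 (R : ℝ)⁻¹) := by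
  rw [tendsto_iff_dist_tendsto_zero]
  refine squeeze_zero' (.of_forall fun _ => dist_nonneg) ?_ tendsto_one_div_atTop_nhds_zero_nat
  filter_upwards [eventually_gt_atTop 0] with T hT
  have hR : (0 : ℝ) < R := by exact_mod_cast (Nat.zero_le c).trans_lt hcR
  have hT' : (0 : ℝ) < T := by exact_mod_cast hT
  have hdist : |(R : ℝ) * ((T + c) / R : ℕ) - T| ≤ R := by
    have hupper : R * ((T + c) / R) ≤ T + R := (Nat.mul_div_le _ _).trans (by omega)
    have hlower : T ≤ R * ((T + c) / R) + R := by
      have := Nat.lt_mul_div_succ (T + c) ((Nat.zero_le c).trans_lt hcR)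
      rw [mul_add, mul_one] at this
      omega
    rw [abs_le]
    constructor
    · linarith [show (T : ℝ) ≤ R * ((T + c) / R : ℕ) + R by exact_mod_cast hlower]
    · linarith [show (R : ℝ) * ((T + c) / R : ℕ) ≤ T + R by exact_mod_cast hupper]
  rw [Real.dist_eq, show ((((T + c) / R : ℕ) : ℝ) / T - (R : ℝ)⁻¹) =
    ((R : ℝ) * ((T + c) / R : ℕ) - T) / (R * T) by field_simp, abs_div, abs_of_pos (mul_pos hR hT'),
    div_le_div_iff₀ (by positivity) hT', one_mul]
  gcongr

theorem sum_range_eq_sum_residues (u : ℕ → ℝ) {R : ℕ} (hR : 0 < R) (T : ℕ) :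
    ∑ t ∈ Finset.range T, u t = ∑ a ∈ Finset.range R,
      ∑ n ∈ Finset.range ((T + (R - 1 - a)) / R), u (a + R * n) := by
  rw [← Finset.sum_fiberwise_of_maps_to (t := Finset.range R) (g := (· % R))
    fun t _ => Finset.mem_range.2 (Nat.mod_lt t hR)]
  refine Finset.sum_congr rfl fun a ha => ?_
  have haR : a < R := Finset.mem_range.1 ha
  refine Finset.sum_nbij' (· / R) (fun n => a + R * n) ?_ ?_ ?_ ?_ ?_
  · intro t ht
    obtain ⟨htT, hta⟩ := Finset.mem_filter.1 ht
    have hdiv := Nat.mod_add_div t R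
    rw [Finset.mem_range] at htT ⊢
    rw [Nat.lt_iff_add_one_le, Nat.le_div_iff_mul_le hR, add_mul, one_mul, mul_comm]
    omega
  · intro n hn
    rw [Finset.mem_range, Nat.lt_iff_add_one_le, Nat.le_div_iff_mul_le hR, add_mul, one_mul,
      mul_comm] at hn
    rw [Finset.mem_filter, Finset.mem_range]
    exact ⟨by omega, by simp [Nat.mod_eq_of_lt haR]⟩
  · intro t ht
    rw [← (Finset.mem_filter.1 ht).2, Nat.mod_add_div]
  · intro n _
    simp [Nat.add_mul_div_left _ _ hR, Nat.div_eq_of_lt haR]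
  · intro t ht
    rw [← (Finset.mem_filter.1 ht).2, Nat.mod_add_div]

theorem tendsto_sum_range_div_of_residues {u : ℕ → ℝ} {c : ℝ} {R : ℕ} (hR : 0 < R)
    (hu : ∀ a < R, Tendsto (fun m : ℕ => (∑ n ∈ Finset.range m, u (a + R * n)) / m) atTop (𝓝 c)) :
    Tendsto (fun T : ℕ => (∑ t ∈ Finset.range T, u t) / T) atTop (𝓝 c) := by
  have hclass (a : ℕ) (ha : a < R) : Tendsto (fun T : ℕ =>
      (∑ n ∈ Finset.range ((T + (R - 1 - a)) / R), u (a + R * n)) / T) atTop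
      (𝓝 (c * (R : ℝ)⁻¹)) := by
    have hcount : Tendsto (fun T => (T + (R - 1 - a)) / R) atTop atTop :=
      (Nat.tendsto_div_const_atTop hR.ne').comp (tendsto_add_atTop_nat _)
    refine (((hu a ha).comp hcount).mul
      (tendsto_add_div_div_atTop (R - 1 - a) (R := R) (by omega))).congr fun T => ?_
    rcases Nat.eq_zero_or_pos ((T + (R - 1 - a)) / R) with hzero | hpos
    · simp [hzero]
    · exact div_mul_div_cancel₀ (Nat.cast_ne_zero.2 hpos.ne')
  have hsum := tendsto_finsetSum (Finset.range R) fun a ha => hclass a (Finset.mem_range.1 ha)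
  have hR' : (R : ℝ) ≠ 0 := by exact_mod_cast hR.ne'
  simp only [← Finset.sum_div, ← sum_range_eq_sum_residues u hR, Finset.sum_const,
    Finset.card_range, nsmul_eq_mul, mul_left_comm (R : ℝ), mul_inv_cancel₀ hR', mul_one] at hsum
  exact hsum

variable {Ω : Type*} [MeasurableSpace Ω] {P : Measure Ω} [IsProbabilityMeasure P] {θ : Ω → Ω}

omit [IsProbabilityMeasure P] in
theorem ae_tendsto_birkhoffAverage_of_indepFun (hθ : MeasurePreserving θ P P) {f : Ω → ℝ}
    (hf : Measurable f) (hint : Integrable f P) {R : ℕ}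
    (hind : ∀ s t, s + R ≤ t → IndepFun (f ∘ θ^[s]) (f ∘ θ^[t]) P) :
    ∀ᵐ ω ∂P, Tendsto (fun T => birkhoffAverage ℝ θ f T ω) atTop (𝓝 (∫ ω, f ω ∂P)) := by
  have hident (t : ℕ) : IdentDistrib (f ∘ θ^[t]) f P P := by
    have h := (hθ.iterate t)
    exact ⟨(hf.comp h.measurable).aemeasurable, hf.aemeasurable, by
      rw [← Measure.map_map hf h.measurable, h.map_eq]⟩
  have hclass (a : ℕ) : ∀ᵐ ω ∂P, Tendsto (fun m : ℕ =>
      (∑ n ∈ Finset.range m, f (θ^[a + (R + 1) * n] ω)) / m) atTop (𝓝 (∫ ω, f ω ∂P)) := by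
    have hpair : Pairwise (Function.onFun (IndepFun · · P)
        fun n => f ∘ θ^[a + (R + 1) * n]) := by
      have hlt {n n' : ℕ} (hn : n < n') : a + (R + 1) * n + R ≤ a + (R + 1) * n' := by
        have := Nat.mul_le_mul_left (R + 1) (Nat.succ_le_of_lt hn)
        rw [Nat.succ_eq_add_one, mul_add] at this
        omega
      intro n n' hne
      rcases hne.lt_or_gt with hn | hn
      · exact hind _ _ (hlt hn)
      · exact (hind _ _ (hlt hn)).symm
    have hmean : ∫ ω, (f ∘ θ^[a + (R + 1) * 0]) ω ∂P = ∫ ω, f ω ∂P := (hident _).integral_eq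
    rw [← hmean]
    exact strong_law_ae_real (fun n => f ∘ θ^[a + (R + 1) * n])
      ((hident _).integrable_iff.2 hint) hpair fun n => (hident _).trans (hident _).symm
  filter_upwards [ae_all_iff.2 hclass] with ω hω
  refine (tendsto_sum_range_div_of_residues (u := fun t => f (θ^[t] ω)) R.succ_pos
    fun a _ => hω a).congr fun T => ?_
  rw [birkhoffAverage, birkhoffSum, smul_eq_mul, div_eq_inv_mul]

theorem ae_tendsto_birkhoffAverage_indicator {ι E : Type*} [Fintype ι] [MeasurableSpace E]
    (hθ : MeasurePreserving θ P P) {g : ι → Ω → E} (hg : ∀ i, Measurable (g i))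
    (hind : iIndepFun (fun (p : ℕ × ι) ω => g p.2 (θ^[p.1] ω)) P) {r : ℕ} {A : Set Ω}
    (hA : MeasurableSet[sigmaGenerated (fun (p : ℕ × ι) ω => g p.2 (θ^[p.1] ω))
      (Finset.range r ×ˢ Finset.univ)] A) :
    ∀ᵐ ω ∂P, Tendsto (fun T => birkhoffAverage ℝ θ (A.indicator 1) T ω) atTop
      (𝓝 (P.real A)) := by
  let F (p : ℕ × ι) (ω : Ω) : E := g p.2 (θ^[p.1] ω)
  have hF (p : ℕ × ι) : Measurable (F p) := (hg p.2).comp (hθ.measurable.iterate p.1)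
  have hshift (s : ℕ) : Measurable[sigmaGenerated F (Finset.Ico s (s + r) ×ˢ Finset.univ)]
      ((A.indicator 1 : Ω → ℝ) ∘ θ^[s]) := by
    refine measurable_comp_of_sigmaGenerated (F := F) (S := Finset.range r ×ˢ Finset.univ)
      (fun p hp => ?_)
      ((measurable_const (a := (1 : ℝ))).indicator hA)
    have hpF : F p ∘ θ^[s] = F (p.1 + s, p.2) := by
      ext ω
      exact congrArg (g p.2) (Function.iterate_add_apply θ p.1 s ω).symm
    rw [hpF]
    simp only [Finset.mem_product, Finset.mem_range, Finset.mem_univ, and_true] at hp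
    exact measurable_sigmaGenerated (by simp; omega)
  have hA' : MeasurableSet A := sigmaGenerated_le (fun p _ => hF p) A hA
  rw [← integral_indicator_one hA']
  refine ae_tendsto_birkhoffAverage_of_indepFun (R := r) hθ (measurable_one.indicator hA')
    ((integrable_const 1).indicator hA') fun s t hst => ?_
  refine indep_of_indep_of_le_left (indep_of_indep_of_le_right
    (indep_sigmaGenerated hind hF ?_) (hshift t).comap_le) (hshift s).comap_le
  exact Finset.disjoint_product.2 (.inl (Finset.Ico_disjoint_Ico_consecutive s _ _ |>.mono_right
    (Finset.Ico_subset_Ico_left hst)))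

omit [MeasurableSpace Ω] in
open Classical in
theorem card_filter_le_add_birkhoffSum {ω : Ω} {B : ℕ → Prop} {A : Set Ω} {r : ℕ}
    (hB : ∀ t, r ≤ t → B t → θ^[t - r] ω ∈ A) (T : ℕ) :
    (((Finset.range T).filter B).card : ℝ) ≤ r + birkhoffSum θ (A.indicator 1) T ω := by
  have hvisits : birkhoffSum θ (A.indicator 1 : Ω → ℝ) T ω =
      ((Finset.range T).filter fun t => θ^[t] ω ∈ A).card := by
    simp [birkhoffSum, Set.indicator_apply]
  have hsubset : (Finset.range T).filter B ⊆ Finset.range r ∪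
      ((Finset.range T).filter fun t => θ^[t] ω ∈ A).image (· + r) := by
    intro t ht
    rw [Finset.mem_filter, Finset.mem_range] at ht
    rcases lt_or_ge t r with htr | hrt
    · exact Finset.mem_union_left _ (Finset.mem_range.2 htr)
    · refine Finset.mem_union_right _ (Finset.mem_image.2 ⟨t - r, ?_, Nat.sub_add_cancel hrt⟩)
      exact Finset.mem_filter.2 ⟨Finset.mem_range.2 (by omega), hB t hrt ht.2⟩
  have hcard := (Finset.card_le_card hsubset).trans <| (Finset.card_union_le _ _).trans <|
    Nat.add_le_add_left Finset.card_image_le _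
  rw [Finset.card_range] at hcard
  rw [hvisits]
  exact_mod_cast hcard

omit [MeasurableSpace Ω] in
open Classical in
theorem limsup_card_div_le {ω : Ω} {B : ℕ → Prop} {A : Set Ω} {r : ℕ} {p : ℝ}
    (hB : ∀ t, r ≤ t → B t → θ^[t - r] ω ∈ A)
    (hA : Tendsto (fun T => birkhoffAverage ℝ θ (A.indicator 1) T ω) atTop (𝓝 p)) :
    limsup (fun T : ℕ => (((Finset.range T).filter B).card : ℝ) / T) atTop ≤ p := by
  have hlim : Tendsto (fun T : ℕ => (r : ℝ) / T + birkhoffAverage ℝ θ (A.indicator 1) T ω) atTop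
      (𝓝 p) := by
    simpa using (tendsto_const_div_atTop_nhds_zero_nat (r : ℝ)).add hA
  rw [← hlim.limsup_eq]
  refine limsup_le_limsup (.of_forall fun T => ?_) ?_ hlim.isBoundedUnder_le
  · dsimp only
    rw [birkhoffAverage, smul_eq_mul, ← div_eq_inv_mul, ← add_div]
    gcongr
    exact card_filter_le_add_birkhoffSum hB T
  · exact (isBoundedUnder_of ⟨0, fun T => by positivity⟩ :
      IsBoundedUnder (· ≥ ·) atTop _).isCoboundedUnder_le

end Frequencies

/-! ### Interactions on the network -/

theorem dist_le_of_dist_succ_le {X : Type*} [PseudoMetricSpace X] {f : ℕ → X → X} {K : ℝ≥0}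
    (hK : K < 1) (hf : ∀ t, LipschitzWith K (f t)) {u v : ℕ → X} {b : ℝ} (h₀ : u 0 = v 0)
    (hu : ∀ t, dist (u (t + 1)) (f t (u t)) ≤ b) (hv : ∀ t, v (t + 1) = f t (v t)) (t : ℕ) :
    dist (u t) (v t) ≤ (1 - (K : ℝ))⁻¹ * b := by
  have hK' : 0 < 1 - (K : ℝ) := sub_pos.2 hK
  induction t with
  | zero =>
    rw [h₀, dist_self]
    exact mul_nonneg (inv_nonneg.2 hK'.le) (dist_nonneg.trans (hu 0))
  | succ t ih =>
    calc dist (u (t + 1)) (v (t + 1))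
        ≤ dist (u (t + 1)) (f t (u t)) + dist (f t (u t)) (f t (v t)) := by
          rw [hv t]
          exact dist_triangle _ _ _
      _ ≤ b + K * dist (u t) (v t) := add_le_add (hu t) ((hf t).dist_le_mul _ _)
      _ ≤ b + K * ((1 - (K : ℝ))⁻¹ * b) := by gcongr
      _ = (1 - (K : ℝ))⁻¹ * b := by field_simp; ring

section Network

variable {Ω : Type*} {N : ℕ} {G : SimpleGraph (Fin N)} {α C : ℝ} {h : Ω → Circ → Circ → ℝ}
  {ω : Ω}

open Classical in
/-- The low degree neighbours `𝒩_i ∩ ℒ_δ` of node `i`. -/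
noncomputable def lowNeighbors (G : SimpleGraph (Fin N)) (δ : ℕ) (i : Fin N) : Finset (Fin N) :=
  G.neighborFinset i ∩ lowDegreeNodes G δ

theorem mem_hubs {Δ : ℕ} {i : Fin N} : i ∈ hubs G Δ ↔ Δ ≤ deg G i := by
  simp [hubs]

theorem mem_lowDegreeNodes {δ : ℕ} {i : Fin N} : i ∈ lowDegreeNodes G δ ↔ deg G i ≤ δ := by
  simp [lowDegreeNodes]

open Classical in
theorem lowNeighbors_subset_neighborFinset (G : SimpleGraph (Fin N)) (δ : ℕ) (i : Fin N) :
    lowNeighbors G δ i ⊆ G.neighborFinset i :=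
  Finset.inter_subset_left

theorem deg_le_largestDegree (G : SimpleGraph (Fin N)) (i : Fin N) :
    deg G i ≤ largestDegree G := by
  classical
  exact G.degree_le_maxDegree i

theorem card_lowNeighbors_le_deg (G : SimpleGraph (Fin N)) (δ : ℕ) (i : Fin N) :
    (lowNeighbors G δ i).card ≤ deg G i :=
  Finset.card_le_card (lowNeighbors_subset_neighborFinset G δ i)

theorem card_lowNeighbors_le_largestDegree (G : SimpleGraph (Fin N)) (δ : ℕ) (i : Fin N) :
    (lowNeighbors G δ i).card ≤ largestDegree G :=
  (card_lowNeighbors_le_deg G δ i).trans (deg_le_largestDegree G i)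

theorem starIndex_mul_deg (G : SimpleGraph (Fin N)) (δ : ℕ) (i : Fin N) :
    starIndex G δ i * deg G i = (lowNeighbors G δ i).card := by
  refine div_mul_cancel_of_imp fun hdeg => ?_
  have hcard := card_lowNeighbors_le_deg G δ i
  rw [Nat.cast_eq_zero.1 hdeg] at hcard
  exact_mod_cast Nat.le_zero.1 hcard

theorem starIndex_le_one (G : SimpleGraph (Fin N)) (δ : ℕ) (i : Fin N) : starIndex G δ i ≤ 1 :=
  div_le_one_of_le₀ (by exact_mod_cast card_lowNeighbors_le_deg G δ i) (Nat.cast_nonneg _)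

open Classical in
theorem interaction_eq (G : SimpleGraph (Fin N)) (α : ℝ) (h : Ω → Circ → Circ → ℝ) (ω : Ω)
    (x : Fin N → Circ) (i : Fin N) :
    interaction G α h ω x i =
      α / largestDegree G * ∑ l ∈ G.neighborFinset i, h ω (x i) (x l) := by
  rw [interaction, ← Finset.sum_filter, mul_one_div, G.neighborFinset_eq_filter]

theorem abs_sum_le_card_mul {ι : Type*} {S : Finset ι} {f : ι → ℝ} (hf : ∀ l ∈ S, |f l| ≤ C) :
    |∑ l ∈ S, f l| ≤ S.card * C := by
  simpa only [nsmul_eq_mul] using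
    (Finset.abs_sum_le_sum_abs f S).trans (Finset.sum_le_card_nsmul S _ C hf)

theorem abs_interaction_le (hα : 0 ≤ α) (hC : ∀ x y, |h ω x y| ≤ C) (x : Fin N → Circ)
    (i : Fin N) : |interaction G α h ω x i| ≤ α * (largestDegree G : ℝ)⁻¹ * deg G i * C := by
  classical
  rw [interaction_eq, abs_mul, abs_of_nonneg (by positivity), div_eq_mul_inv, mul_assoc _ _ C]
  gcongr
  exact abs_sum_le_card_mul fun l _ => hC (x i) (x l)

theorem dist_networkOrbit_le [MeasurableSpace Ω] {K : ℝ≥0} {θ : Ω → Ω}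
    {φ : Fin N → ℕ → Ω → Circ → Circ} {δ : ℕ} {j : Fin N} (hφ : IsRDS θ (φ j)) (hα : 0 ≤ α)
    (hK : K < 1) (hlip : ∀ ω, LipschitzWith K (φ j 1 ω)) (hC : ∀ t x y, |h (θ^[t] ω) x y| ≤ C)
    (hj : j ∈ lowDegreeNodes G δ) (x : Fin N → Circ) (t : ℕ) :
    dist (networkOrbit G α θ φ h t ω x j) (φ j t ω (x j)) ≤
      (1 - (K : ℝ))⁻¹ * (α * (largestDegree G : ℝ)⁻¹ * δ * C) := by
  have hC₀ : 0 ≤ C := (abs_nonneg _).trans (hC 0 0 0)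
  refine dist_le_of_dist_succ_le (f := fun t => φ j 1 (θ^[t] ω)) hK (fun t => hlip _)
    (u := fun t => networkOrbit G α θ φ h t ω x j) (v := fun t => φ j t ω (x j))
    (hφ.zero ω (x j)).symm (fun t => ?_) (fun t => hφ.succ_apply t ω (x j)) t
  rw [networkOrbit, dist_self_add_left]
  refine (QuotientAddGroup.norm_mk_le_norm).trans
    ((abs_interaction_le hα (hC t) _ j).trans ?_)
  gcongr
  exact mem_lowDegreeNodes.1 hj

open Classical in
theorem fluctuation_eq (G : SimpleGraph (Fin N)) (α : ℝ) (h : Ω → Circ → Circ → ℝ) (δ : ℕ)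
    (m : Measure Circ) (i : Fin N) (ω : Ω) (x y : Fin N → Circ) :
    fluctuation G α h (α * (starIndex G δ i * deg G i / largestDegree G)) m i ω x =
      α / largestDegree G *
        (∑ l ∈ G.neighborFinset i \ lowNeighbors G δ i, h ω (x i) (x l) +
          ∑ l ∈ lowNeighbors G δ i, (h ω (x i) (x l) - h ω (x i) (y l)) +
          ∑ l ∈ lowNeighbors G δ i, (h ω (x i) (y l) - ∫ z, h ω (x i) z ∂m)) := by
  rw [fluctuation, interaction_eq, starIndex_mul_deg,
    ← Finset.sum_sdiff (lowNeighbors_subset_neighborFinset G δ i)]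
  simp only [Finset.sum_sub_distrib, Finset.sum_const, nsmul_eq_mul]
  ring

theorem abs_fluctuation_le {L η : ℝ} {δ : ℕ} (hα : 0 ≤ α) (hC : ∀ x y, |h ω x y| ≤ C)
    (hL : ∀ x y y', |h ω x y - h ω x y'| ≤ L * dist y y') (hL₀ : 0 ≤ L) (m : Measure Circ)
    (i : Fin N) {x y : Fin N → Circ} (hη : ∀ l ∈ lowDegreeNodes G δ, dist (x l) (y l) ≤ η)
    (hη₀ : 0 ≤ η) :
    |fluctuation G α h (α * (starIndex G δ i * deg G i / largestDegree G)) m i ω x| ≤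
      α * (1 - starIndex G δ i) * C + α * L * η + α / largestDegree G *
        |∑ l ∈ lowNeighbors G δ i, (h ω (x i) (y l) - ∫ z, h ω (x i) z ∂m)| := by
  classical
  have hC₀ : 0 ≤ C := (abs_nonneg _).trans (hC 0 0)
  have hdeg : (deg G i : ℝ) ≤ largestDegree G := by exact_mod_cast deg_le_largestDegree G i
  have hlow : ((lowNeighbors G δ i).card : ℝ) ≤ largestDegree G := by
    exact_mod_cast card_lowNeighbors_le_largestDegree G δ i
  have hscale {k a : ℝ} (hk : k ≤ largestDegree G) (ha : 0 ≤ a) :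
      α / largestDegree G * (k * a) ≤ α * a := by
    rw [← mul_assoc, div_mul_eq_mul_div, mul_div_assoc]
    gcongr
    exact mul_le_of_le_one_right hα (div_le_one_of_le₀ hk (Nat.cast_nonneg _))
  have hhigh : |∑ l ∈ G.neighborFinset i \ lowNeighbors G δ i, h ω (x i) (x l)| ≤
      deg G i * ((1 - starIndex G δ i) * C) := by
    refine (abs_sum_le_card_mul fun l _ => hC (x i) (x l)).trans_eq ?_
    rw [Finset.cast_card_sdiff (lowNeighbors_subset_neighborFinset G δ i), ← starIndex_mul_deg,
      show ((G.neighborFinset i).card : ℝ) = deg G i from rfl]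
    ring
  have hshadow : |∑ l ∈ lowNeighbors G δ i, (h ω (x i) (x l) - h ω (x i) (y l))| ≤
      (lowNeighbors G δ i).card * (L * η) :=
    abs_sum_le_card_mul fun l hl => (hL (x i) (x l) (y l)).trans <|
      mul_le_mul_of_nonneg_left (hη l (Finset.mem_inter.1 hl).2) hL₀
  rw [fluctuation_eq (y := y), abs_mul, abs_of_nonneg (by positivity), mul_assoc α, mul_assoc α]
  refine (mul_le_mul_of_nonneg_left (abs_add_three _ _ _) (by positivity)).trans ?_
  rw [mul_add, mul_add]
  refine add_le_add_left (add_le_add ?_ ?_) _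
  · exact (mul_le_mul_of_nonneg_left hhigh (by positivity)).trans
      (hscale hdeg (mul_nonneg (sub_nonneg.2 (starIndex_le_one G δ i)) hC₀))
  · exact (mul_le_mul_of_nonneg_left hshadow (by positivity)).trans (hscale hlow (by positivity))

end Network

section Suprema

variable {Ω : Type*} {θ : Ω → Ω} {h : Ω → Circ → Circ → ℝ} {ω : Ω}

theorem normC4_le_supC4 (hb : BddAbove (Set.range fun t : ℕ => normC4 (h (θ^[t] ω)))) (t : ℕ) :
    normC4 (h (θ^[t] ω)) ≤ supC4 θ h ω :=
  le_ciSup hb t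

theorem abs_le_supC0 (hh : ∀ ω, IsC4 (h ω))
    (hb : BddAbove (Set.range fun t : ℕ => normC4 (h (θ^[t] ω)))) (t : ℕ) (x y : Circ) :
    |h (θ^[t] ω) x y| ≤ supC0 θ h ω := by
  refine ((hh _).abs_le_normC0 x y).trans
    (le_ciSup (f := fun t : ℕ => normC0 (h (θ^[t] ω))) ⟨supC4 θ h ω, ?_⟩ t)
  rintro _ ⟨s, rfl⟩
  exact (hh _).normC0_le_normC4.trans (normC4_le_supC4 hb s)

theorem abs_sub_le_supLip_mul_dist (hh : ∀ ω, IsC4 (h ω))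
    (hb : BddAbove (Set.range fun t : ℕ => normC4 (h (θ^[t] ω)))) (t : ℕ) (x y y' : Circ) :
    |h (θ^[t] ω) x y - h (θ^[t] ω) x y'| ≤ supLip θ h ω * dist y y' := by
  refine ((hh _).abs_sub_le_lipSeminorm_mul_dist x y y').trans
    (mul_le_mul_of_nonneg_right ?_ dist_nonneg)
  refine le_ciSup (f := fun t : ℕ => lipSeminorm (h (θ^[t] ω))) ⟨2 * supC4 θ h ω, ?_⟩ t
  rintro _ ⟨s, rfl⟩
  exact (hh _).lipSeminorm_le.trans (mul_le_mul_of_nonneg_left (normC4_le_supC4 hb s) zero_le_two)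

theorem supLip_nonneg (θ : Ω → Ω) (h : Ω → Circ → Circ → ℝ) (ω : Ω) : 0 ≤ supLip θ h ω :=
  Real.iSup_nonneg fun _ => Real.iSup_nonneg fun _ => by positivity

theorem supC4_nonneg (θ : Ω → Ω) (h : Ω → Circ → Circ → ℝ) (ω : Ω) : 0 ≤ supC4 θ h ω :=
  Real.iSup_nonneg fun _ => Real.iSup_nonneg fun _ => abs_nonneg _

end Suprema

/-! ### Reduction of the node dynamics -/

section Averages

variable {Ω ι : Type*} [MeasurableSpace Ω] {P : Measure Ω} {θ : Ω → Ω}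
  {φ : ι → ℕ → Ω → Circ → Circ}

theorem iIndepFun_iterate_of_prod
    (hind : iIndepFun (fun (p : ℕ × ι) ω => φ p.2 1 (θ^[p.1] ω)) P) (i : ι) :
    iIndepFun (fun (t : ℕ) ω => φ i 1 (θ^[t] ω)) P :=
  hind.precomp (g := fun t : ℕ => (t, i)) fun _ _ h => congrArg Prod.fst h

variable [IsProbabilityMeasure P]

theorem norm_sum_fourier_sub_integral_le_of_notMem {f : ι → Ω → Circ → Circ} {m : Measure Circ}
    [IsProbabilityMeasure m] (hf : ∀ j, Measurable (Function.uncurry (f j)))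
    (hm : ∀ j, IsStationary P (f j) m) {κ : ℝ≥0} (hlip : ∀ j ω, LipschitzWith κ (f j ω))
    {p : Circ} {S : Finset ι} {q : ℝ} {ω : Ω}
    (hω : ω ∉ characterDeviation P (fun j ω => f j ω p) S q) (z : ι → Circ) {k : ℤ} (hk : k ≠ 0) :
    ‖∑ j ∈ S, (fourier k (f j ω (z j)) - ∫ y, fourier k y ∂m)‖ ≤
      (2 * q + 2 * Real.pi * S.card * κ) * |(k : ℝ)| := by
  have hclose (j : ι) (ω : Ω) (x y : Circ) :
      ‖fourier k (f j ω x) - fourier k (f j ω y)‖ ≤ Real.pi * |(k : ℝ)| * κ := by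
    calc _ ≤ 2 * Real.pi * |(k : ℝ)| * dist (f j ω x) (f j ω y) := norm_fourier_sub_le k _ _
      _ ≤ 2 * Real.pi * |(k : ℝ)| * (κ * (1 / 2)) := by
          gcongr
          exact ((hlip j ω).dist_le_mul x y).trans (by gcongr; exact dist_le_half x y)
      _ = Real.pi * |(k : ℝ)| * κ := by ring
  have hbias (j : ι) : ‖∫ ω, fourier k (f j ω p) ∂P - ∫ y, fourier k y ∂m‖ ≤
      Real.pi * |(k : ℝ)| * κ :=
    (hm j).norm_integral_sub_integral_le (hf j) (fourier k).continuous p fun ω x => hclose j ω p x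
  have hdev : ‖∑ j ∈ S, (fourier k (f j ω p) - ∫ ω', fourier k (f j ω' p) ∂P)‖ ≤
      2 * q * |(k : ℝ)| :=
    not_lt.1 fun hlt => hω ⟨k, hk, hlt⟩
  have hsplit : ∑ j ∈ S, (fourier k (f j ω (z j)) - ∫ y, fourier k y ∂m) =
      ∑ j ∈ S, (fourier k (f j ω p) - ∫ ω', fourier k (f j ω' p) ∂P) +
        ∑ j ∈ S, ((fourier k (f j ω (z j)) - fourier k (f j ω p)) +
          (∫ ω', fourier k (f j ω' p) ∂P - ∫ y, fourier k y ∂m)) := by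
    rw [← Finset.sum_add_distrib]
    exact Finset.sum_congr rfl fun j _ => by ring
  have herror : ‖∑ j ∈ S, ((fourier k (f j ω (z j)) - fourier k (f j ω p)) +
      (∫ ω', fourier k (f j ω' p) ∂P - ∫ y, fourier k y ∂m))‖ ≤
      S.card * (2 * (Real.pi * |(k : ℝ)| * κ)) := by
    rw [← nsmul_eq_mul, ← Finset.sum_const]
    refine norm_sum_le_of_le S fun j _ => (norm_add_le _ _).trans ?_
    linarith [hclose j ω (z j) p, hbias j]
  rw [hsplit]
  linarith [norm_add_le (∑ j ∈ S, (fourier k (f j ω p) - ∫ ω', fourier k (f j ω' p) ∂P))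
    (∑ j ∈ S, ((fourier k (f j ω (z j)) - fourier k (f j ω p)) +
      (∫ ω', fourier k (f j ω' p) ∂P - ∫ y, fourier k y ∂m)))]

theorem measurable_map_iterate (hθ : Measurable θ) (hφ : ∀ j, IsRDS θ (φ j)) (p : ℕ × ι) :
    Measurable fun ω => φ p.2 1 (θ^[p.1] ω) :=
  ((hφ p.2).measurable_map 1).comp (hθ.iterate p.1)

theorem iIndepFun_apply (hθ : Measurable θ) (hφ : ∀ j, IsRDS θ (φ j))
    (hc : ∀ j ω, Continuous (φ j 1 ω))
    (hind : iIndepFun (fun (p : ℕ × ι) ω => φ p.2 1 (θ^[p.1] ω)) P) (r : ℕ) (x : Circ) :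
    iIndepFun (fun j ω => φ j r ω x) P := by
  refine (iIndepFun_iff_iIndep _ _ _).2 <| iIndep_of_iIndep_of_le
    (iIndep_sigmaGenerated hind (measurable_map_iterate hθ hφ)
      (S := fun j => Finset.range r ×ˢ {j}) fun i j hij => ?_)
    fun j => ((hφ j).measurable_of_measurable_maps (hc j) (fun t ht =>
      measurable_sigmaGenerated (F := fun (p : ℕ × ι) ω => φ p.2 1 (θ^[p.1] ω)) (p := (t, j))
        (by simpa using ht)) x).comap_le
  exact Finset.disjoint_product.2 (.inr (Finset.disjoint_singleton.2 hij))

theorem ae_forall_tendsto_birkhoffAverage_characterDeviation [Finite ι]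
    (hθ : MeasurePreserving θ P P) (hφ : ∀ j, IsRDS θ (φ j)) (hc : ∀ j ω, Continuous (φ j 1 ω))
    (hind : iIndepFun (fun (p : ℕ × ι) ω => φ p.2 1 (θ^[p.1] ω)) P) (x : Circ) :
    ∀ᵐ ω ∂P, ∀ (r : ℕ) (S : Finset ι) (q : ℚ), Tendsto (fun T => birkhoffAverage ℝ θ
      ((characterDeviation P (fun j ω => φ j r ω x) S q).indicator 1) T ω) atTop
      (𝓝 (P.real (characterDeviation P (fun j ω => φ j r ω x) S q))) := by
  cases nonempty_fintype ι
  simp only [ae_all_iff]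
  refine fun r S q => ae_tendsto_birkhoffAverage_indicator hθ
    (fun j => (hφ j).measurable_map 1) hind (r := r)
    (measurableSet_characterDeviation P (fun j => ?_) S q)
  exact (hφ j).measurable_of_measurable_maps (hc j) (fun t ht =>
    measurable_sigmaGenerated (F := fun (p : ℕ × ι) ω => φ p.2 1 (θ^[p.1] ω)) (p := (t, j))
      (by simpa using ht)) x

end Averages

section Reduction

theorem mul_exp_neg_div_le_mul_exp_neg_div {a b c : ℝ} (ha : 0 ≤ a) (hab : a ≤ b) (hc : 0 ≤ c) :
    a * Real.exp (-(c / a)) ≤ b * Real.exp (-(c / b)) := by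
  rcases ha.eq_or_lt with rfl | ha
  · rw [zero_mul]
    positivity
  · have hb : 0 ≤ b := ha.le.trans hab
    gcongr

theorem deviation_bound_le {a D q α ε H : ℝ} (hα : 0 < α) (hε : 0 < ε) (hH : 0 < H) (hD : 0 < D)
    (ha : 0 ≤ a) (haD : a ≤ D) (hq : 30 * ε * D / (α * H) ≤ q) :
    8 * (a / q) * Real.exp (-(q ^ 2 / (2 * a))) ≤
      4 * (α * ε⁻¹ * H) * Real.exp (-(D * ε ^ 2 * (α ^ 2)⁻¹ * (450 / H ^ 2))) := by
  have hq₀ : 0 < 30 * ε * D / (α * H) := by positivity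
  have hqpos : 0 < q := hq₀.trans_le hq
  calc 8 * (a / q) * Real.exp (-(q ^ 2 / (2 * a)))
      = 8 / q * (a * Real.exp (-(q ^ 2 / 2 / a))) := by rw [div_div]; ring
    _ ≤ 8 / q * (D * Real.exp (-(q ^ 2 / 2 / D))) := by
        gcongr 8 / q * ?_
        exact mul_exp_neg_div_le_mul_exp_neg_div ha haD (by positivity)
    _ ≤ 8 / (30 * ε * D / (α * H)) *
          (D * Real.exp (-((30 * ε * D / (α * H)) ^ 2 / 2 / D))) := by gcongr
    _ = 4 / 15 * (α * ε⁻¹ * H) * Real.exp (-(D * ε ^ 2 * (α ^ 2)⁻¹ * (450 / H ^ 2))) := by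
        rw [show (30 * ε * D / (α * H)) ^ 2 / 2 / D = D * ε ^ 2 * (α ^ 2)⁻¹ * (450 / H ^ 2) by
          field_simp; norm_num]
        field_simp
        norm_num
    _ ≤ 4 * (α * ε⁻¹ * H) * Real.exp (-(D * ε ^ 2 * (α ^ 2)⁻¹ * (450 / H ^ 2))) := by
        gcongr
        norm_num

variable {Ω : Type*} {N : ℕ} {G : SimpleGraph (Fin N)} {θ : Ω → Ω}
  {φ : Fin N → ℕ → Ω → Circ → Circ} {h : Ω → Circ → Circ → ℝ} {m : Measure Circ} {α ε : ℝ}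
  {δ : ℕ} {ω : Ω}

theorem AdmitsReduction.mono {a ε' ρ ρ' : ℝ} {i : Fin N} {x : Fin N → Circ}
    (hred : AdmitsReduction G α θ φ h a m i ω x ε ρ) (hε : ε ≤ ε') (hρ : ρ ≤ ρ') :
    AdmitsReduction G α θ φ h a m i ω x ε' ρ' := by
  refine (limsup_le_limsup (.of_forall fun T => ?_) ?_ ?_).trans (hred.trans hρ)
  · gcongr
  · exact (isBoundedUnder_of ⟨0, fun T => by positivity⟩ :
      IsBoundedUnder (· ≥ ·) atTop _).isCoboundedUnder_le
  · refine isBoundedUnder_of ⟨1, fun T => div_le_one_of_le₀ ?_ T.cast_nonneg⟩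
    exact_mod_cast (Finset.card_filter_le _ _).trans_eq (Finset.card_range T)

theorem fluctuation_eq_zero {ω : Ω} (hzero : ∀ y z, h ω y z = 0) (a : ℝ) (m : Measure Circ)
    (i : Fin N) (x : Fin N → Circ) : fluctuation G α h a m i ω x = 0 := by
  simp [fluctuation, interaction, hzero]

theorem admitsReduction_of_supC4_eq_zero (hh : ∀ ω, IsC4 (h ω))
    (hb : BddAbove (Set.range fun t : ℕ => normC4 (h (θ^[t] ω)))) (hH : supC4 θ h ω = 0)
    (hε : 0 ≤ ε) (a : ℝ) (m : Measure Circ) (i : Fin N) (x : Fin N → Circ) :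
    AdmitsReduction G α θ φ h a m i ω x ε 0 := by
  have hzero (t : ℕ) (y z : Circ) : h (θ^[t] ω) y z = 0 :=
    abs_nonpos_iff.1 (((hh _).abs_le_normC4 y z).trans ((normC4_le_supC4 hb t).trans_eq hH))
  simp [AdmitsReduction, fluctuation_eq_zero (hzero _), hε.not_gt]

variable [MeasurableSpace Ω] {P : Measure Ω} [IsProbabilityMeasure P] [IsProbabilityMeasure m]
  {K : ℝ≥0}

theorem abs_fluctuation_networkOrbit_le (hφ : ∀ j, IsRDS θ (φ j)) (hK : K < 1)
    (hlip : ∀ j ω, LipschitzWith K (φ j 1 ω)) (hh : ∀ ω, IsC4 (h ω)) (hα : 0 ≤ α)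
    (hb : BddAbove (Set.range fun t : ℕ => normC4 (h (θ^[t] ω)))) (x : Fin N → Circ) (i : Fin N)
    {r t : ℕ} (hrt : r ≤ t) (hm : ∀ j, IsStationary P (φ j r) m) {q : ℝ}
    (hq : 2 * Real.pi * (lowNeighbors G δ i).card * K ^ r ≤ q)
    (hgood : θ^[t - r] ω ∉
      characterDeviation P (fun j ω => φ j r ω 0) (lowNeighbors G δ i) q) :
    |fluctuation G α h (α * (starIndex G δ i * deg G i / largestDegree G)) m i (θ^[t] ω)
        (networkOrbit G α θ φ h t ω x)| ≤
      α * (1 - starIndex G δ i) * supC0 θ h ω +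
        α * supLip θ h ω * ((1 - (K : ℝ))⁻¹ *
          (α * (largestDegree G : ℝ)⁻¹ * δ * supC0 θ h ω)) +
        α / largestDegree G * (supC4 θ h ω * (3 * q) / 400) := by
  have hC := abs_le_supC0 hh hb
  have hC₀ : 0 ≤ supC0 θ h ω := (abs_nonneg _).trans (hC 0 0 0)
  have hK' : 0 < 1 - (K : ℝ) := sub_pos.2 hK
  have hisolated (j : Fin N) : φ j r (θ^[t - r] ω) (φ j (t - r) ω (x j)) = φ j t ω (x j) := by
    rw [← (hφ j).cocycle, Nat.add_sub_cancel' hrt]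
  have haverage : |∑ l ∈ lowNeighbors G δ i,
      (h (θ^[t] ω) (networkOrbit G α θ φ h t ω x i) (φ l t ω (x l)) -
        ∫ z, h (θ^[t] ω) (networkOrbit G α θ φ h t ω x i) z ∂m)| ≤
      supC4 θ h ω * (3 * q) / 400 := by
    refine abs_sum_sub_integral_le _ _ m ((hh _).contDiff_right _) (fun u =>
      ((hh _).abs_iteratedDeriv_right_le le_rfl _ u).trans (normC4_le_supC4 hb t)) fun k hk => ?_
    simp only [← hisolated]
    refine (norm_sum_fourier_sub_integral_le_of_notMem (fun j => (hφ j).measurable_uncurry r) hm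
      (fun j => (hφ j).lipschitzWith (hlip j) r) hgood _ hk).trans ?_
    push_cast
    gcongr
    linarith
  refine (abs_fluctuation_le hα (hC t) (abs_sub_le_supLip_mul_dist hh hb t)
    (supLip_nonneg θ h ω) m i (fun l hl => dist_networkOrbit_le (hφ l) hα hK (hlip l) hC hl x t)
    (by positivity)).trans ?_
  gcongr

theorem mem_characterDeviation_of_lt_abs_fluctuation (hφ : ∀ j, IsRDS θ (φ j)) (hK : K < 1)
    (hlip : ∀ j ω, LipschitzWith K (φ j 1 ω)) (hh : ∀ ω, IsC4 (h ω)) (hα : 0 < α)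
    (hb : BddAbove (Set.range fun t : ℕ => normC4 (h (θ^[t] ω)))) (hD : 0 < largestDegree G)
    (hshadow : 4 * α ^ 2 * (δ : ℝ) * (largestDegree G : ℝ)⁻¹ * (1 - (K : ℝ))⁻¹ *
      supC0 θ h ω * supLip θ h ω ≤ ε) (x : Fin N → Circ) (i : Fin N)
    {r t : ℕ} (hrt : r ≤ t) (hm : ∀ j, IsStationary P (φ j r) m) {q : ℝ}
    (hr : 2 * Real.pi * (lowNeighbors G δ i).card * K ^ r ≤ q)
    (hq : supC4 θ h ω * q * α ≤ 100 * ε * largestDegree G)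
    (hbad : ε + α * (1 - starIndex G δ i) * supC0 θ h ω <
      |fluctuation G α h (α * (starIndex G δ i * deg G i / largestDegree G)) m i (θ^[t] ω)
        (networkOrbit G α θ φ h t ω x)|) :
    θ^[t - r] ω ∈ characterDeviation P (fun j ω => φ j r ω 0) (lowNeighbors G δ i) q := by
  by_contra hgood
  have hfluct := abs_fluctuation_networkOrbit_le hφ hK hlip hh hα.le hb x i hrt hm hr hgood
  have hshadow' : α * supLip θ h ω *
      ((1 - (K : ℝ))⁻¹ * (α * (largestDegree G : ℝ)⁻¹ * δ * supC0 θ h ω)) ≤ ε / 4 := by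
    linarith
  have haverage : α / largestDegree G * (supC4 θ h ω * (3 * q) / 400) ≤ 3 / 4 * ε := by
    rw [div_mul_eq_mul_div, div_le_iff₀ (by exact_mod_cast hD)]
    linarith
  linarith only [hbad, hfluct, hshadow', haverage]

theorem admitsReduction_of_tendsto_birkhoffAverage (hθ : MeasurePreserving θ P P)
    (hφ : ∀ j, IsRDS θ (φ j)) (hK : K < 1) (hlip : ∀ j ω, LipschitzWith K (φ j 1 ω))
    (hind : iIndepFun (fun (p : ℕ × Fin N) ω => φ p.2 1 (θ^[p.1] ω)) P)
    (hm : ∀ j r, IsStationary P (φ j r) m) (hh : ∀ ω, IsC4 (h ω)) (hα : 0 < α) (hε : 0 < ε)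
    (hb : BddAbove (Set.range fun t : ℕ => normC4 (h (θ^[t] ω)))) (hD : 0 < largestDegree G)
    (hshadow : 4 * α ^ 2 * (δ : ℝ) * (largestDegree G : ℝ)⁻¹ * (1 - (K : ℝ))⁻¹ *
      supC0 θ h ω * supLip θ h ω ≤ ε)
    (hω : ∀ (r : ℕ) (S : Finset (Fin N)) (q : ℚ), Tendsto (fun T => birkhoffAverage ℝ θ
      ((characterDeviation P (fun j ω => φ j r ω 0) S q).indicator 1) T ω) atTop
      (𝓝 (P.real (characterDeviation P (fun j ω => φ j r ω 0) S q))))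
    (x : Fin N → Circ) (i : Fin N) :
    AdmitsReduction G α θ φ h (α * (starIndex G δ i * deg G i / largestDegree G)) m i ω x
      (ε + α * (1 - starIndex G δ i) * supC0 θ h ω)
      (4 * (α * ε⁻¹ * supC4 θ h ω) * Real.exp
        (-(largestDegree G * ε ^ 2 * (α ^ 2)⁻¹ * (450 / supC4 θ h ω ^ 2)))) := by
  rcases (supC4_nonneg θ h ω).eq_or_lt with hH | hH
  · have hC : 0 ≤ supC0 θ h ω := (abs_nonneg _).trans (abs_le_supC0 hh hb 0 0 0)
    have hs : 0 ≤ 1 - starIndex G δ i := sub_nonneg.2 (starIndex_le_one G δ i)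
    simpa [← hH] using admitsReduction_of_supC4_eq_zero hh hb hH.symm (by positivity) _ m i x
  have hD' : (0 : ℝ) < largestDegree G := by exact_mod_cast hD
  -- The lower bound on `q` gives the exponent `450 = 30 ^ 2 / 2`; the upper bound keeps the
  -- deviation below `3 * ε / 4`, and the shadowing error uses up the remaining `ε / 4`.
  obtain ⟨q, hq₁, hq₂⟩ := exists_rat_btwn
    (show 30 * ε * largestDegree G / (α * supC4 θ h ω) <
      100 * ε * largestDegree G / (α * supC4 θ h ω) by gcongr; norm_num)
  have hq₀ : (0 : ℝ) < q := lt_of_le_of_lt (by positivity) hq₁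
  have hr : ∀ᶠ r : ℕ in atTop, 2 * Real.pi * (lowNeighbors G δ i).card * (K : ℝ) ^ r < q := by
    refine Tendsto.eventually_lt_const hq₀ ?_
    simpa using (tendsto_pow_atTop_nhds_zero_of_lt_one K.coe_nonneg hK).const_mul
      (2 * Real.pi * (lowNeighbors G δ i).card)
  obtain ⟨r, hr⟩ := hr.exists
  have hc (j : Fin N) (ω : Ω) : Continuous (φ j 1 ω) := (hlip j ω).continuous
  refine (limsup_card_div_le (fun t hrt hbad => mem_characterDeviation_of_lt_abs_fluctuation hφ hK
    hlip hh hα hb hD hshadow x i hrt (hm · r) hr.le ?_ hbad) (hω r (lowNeighbors G δ i) q)).trans ?_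
  · rw [lt_div_iff₀ (by positivity)] at hq₂
    linarith
  · refine (measureReal_characterDeviation_le (iIndepFun_apply hθ.measurable hφ hc hind r 0)
      (fun j => ((hφ j).measurable_uncurry r).of_uncurry_right) _ hq₀).trans ?_
    exact deviation_bound_le hα hε hH hD' (Nat.cast_nonneg _)
      (by exact_mod_cast card_lowNeighbors_le_largestDegree G δ i) hq₁.le

theorem ae_admitsReduction (hθ : MeasurePreserving θ P P) (hφ : ∀ j, IsRDS θ (φ j)) (hK : K < 1)
    (hlip : ∀ j ω, LipschitzWith K (φ j 1 ω))
    (hind : iIndepFun (fun (p : ℕ × Fin N) ω => φ p.2 1 (θ^[p.1] ω)) P)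
    (hm : ∀ j, IsStationary P (φ j 1) m) (hh : ∀ ω, IsC4 (h ω)) (hα : 0 < α) {Δ : ℕ} (hΔ : 0 < Δ)
    {ν : ℝ} (hstar : IsLocallyStarLike G Δ δ ν) :
    ∀ᵐ ω ∂P, BddAbove (Set.range fun t : ℕ => normC4 (h (θ^[t] ω))) → ∀ (x : Fin N → Circ) (ε : ℝ),
      0 < ε → 4 * α ^ 2 * (δ : ℝ) * (largestDegree G : ℝ)⁻¹ * (1 - (K : ℝ))⁻¹ *
        supC0 θ h ω * supLip θ h ω ≤ ε → ∀ i ∈ hubs G Δ,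
      AdmitsReduction G α θ φ h (α * (starIndex G δ i * deg G i / largestDegree G)) m i ω x
        (ε + α * (1 - ν) * supC0 θ h ω)
        (4 * ((hubs G Δ).card : ℝ) * (α * ε⁻¹ * supC4 θ h ω) * Real.exp
          (-(ν * Δ * ε ^ 2 * (α ^ 2)⁻¹ * (450 / supC4 θ h ω ^ 2)))) := by
  have hc (j : Fin N) (ω : Ω) : Continuous (φ j 1 ω) := (hlip j ω).continuous
  have hm' (j : Fin N) (r : ℕ) : IsStationary P (φ j r) m :=
    (hφ j).isStationary hθ (hc j) (iIndepFun_iterate_of_prod hind j) (hm j) r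
  filter_upwards [ae_forall_tendsto_birkhoffAverage_characterDeviation hθ hφ hc hind 0] with
    ω hω hb x ε hε hshadow i hi
  have hΔD : (Δ : ℝ) ≤ largestDegree G := by
    exact_mod_cast (mem_hubs.1 hi).trans (deg_le_largestDegree G i)
  have hνΔ : ν * Δ ≤ largestDegree G :=
    (mul_le_of_le_one_left Δ.cast_nonneg ((hstar i hi).trans (starIndex_le_one G δ i))).trans hΔD
  have hM : (1 : ℝ) ≤ (hubs G Δ).card := by exact_mod_cast Finset.card_pos.2 ⟨i, hi⟩
  have hC : 0 ≤ supC0 θ h ω := (abs_nonneg _).trans (abs_le_supC0 hh hb 0 0 0)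
  have hH := supC4_nonneg θ h ω
  refine (admitsReduction_of_tendsto_birkhoffAverage hθ hφ hK hlip hind hm' hh hα hε hb
    (hΔ.trans_le (by exact_mod_cast hΔD)) hshadow hω x i).mono ?_ ?_
  · gcongr
    exact hstar i hi
  · gcongr
    exact le_mul_of_one_le_right (by norm_num) hM

end Reduction

end HubReduction

theorem mainTheorem9_general {Ω : Type*} [MeasurableSpace Ω] {P : Measure Ω}
    [IsProbabilityMeasure P] {N : ℕ} {G : SimpleGraph (Fin N)} {Δ δ : ℕ} {ν : ℝ} {θ : Ω → Ω}
    {φ : Fin N → ℕ → Ω → Circ → Circ} {h : Ω → Circ → Circ → ℝ} {m₀ : Measure Circ}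
    [IsProbabilityMeasure m₀] {α : ℝ} {K : NNReal} (hΔ : 0 < Δ) (hstar : IsLocallyStarLike G Δ δ ν)
    (hθ : MeasurePreserving θ P P) (hφ : ∀ i, IsRDS θ (φ i))
    (hind : iIndepFun (fun (p : ℕ × Fin N) ω => φ p.2 1 (θ^[p.1] ω)) P)
    (hm : ∀ i, IsStationary P (φ i 1) m₀) (hh : ∀ ω, IsC4 (h ω)) (hα : 0 < α) (hK : K < 1)
    (hlip : ∀ i ω, LipschitzWith K (φ i 1 ω)) :
    (∀ i, m₀ = P.map (codingMap θ (φ i 1))) ∧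
    ∀ᵐ ω ∂P, BddAbove (Set.range fun t : ℕ => normC4 (h (θ^[t] ω))) →
    ∀ x : Fin N → Circ,
      (∀ j ∈ lowDegreeNodes G δ, ∀ t : ℕ,
        dist (networkOrbit G α θ φ h t ω x j) (φ j t ω (x j)) ≤
          (1 - (K : ℝ))⁻¹ * (α * (largestDegree G : ℝ)⁻¹ * δ * supC0 θ h ω)) ∧
      ∀ ε : ℝ, 0 < ε →
        4 * α ^ 2 * (δ : ℝ) * (largestDegree G : ℝ)⁻¹ * (1 - (K : ℝ))⁻¹ *
          supC0 θ h ω * supLip θ h ω ≤ ε →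
        ∀ i ∈ hubs G Δ,
          AdmitsReduction G α θ φ h (α * (starIndex G δ i * deg G i / largestDegree G)) m₀ i ω x
            (ε + α * (1 - ν) * supC0 θ h ω)
            (4 * ((hubs G Δ).card : ℝ) * (α * ε⁻¹ * supC4 θ h ω) *
              Real.exp (-(ν * Δ * ε ^ 2 * (α ^ 2)⁻¹ * (450 / supC4 θ h ω ^ 2)))) := by
  refine ⟨fun i => (hm i).eq_map_codingMap hθ ((hφ i).measurable_uncurry 1) hK (hlip i)
    (iIndepFun_iterate_of_prod hind i), ?_⟩
  filter_upwards [ae_admitsReduction hθ hφ hK hlip hind hm hh hα hΔ hstar] with ω hω hb x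
  exact ⟨fun j hj t => dist_networkOrbit_le (hφ j) hα.le hK (hlip j) (abs_le_supC0 hh hb) hj x t,
    hω hb x⟩

theorem mainTheorem9 :
    ∃ (c₁ c₂ : ℝ) (D : ℝ → ℝ → ℝ → ℝ), 0 < c₁ ∧ c₁ ≤ c₂ ∧
      (∀ α ε H : ℝ, 0 < α → 0 < ε → 0 ≤ H →
        c₁ * (α * ε⁻¹ * H) ≤ D α ε H ∧ D α ε H ≤ c₂ * (α * ε⁻¹ * H)) ∧
      ∀ (β lamHub lamLdn : ℝ) (m w : ℕ → ℝ) (Δ δ : ℕ → ℕ),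
        PowerLawRegime β lamHub lamLdn m w Δ δ →
      ∀ N : ℕ, ∀ᵐ G ∂(chungLuLaw β N (m N) (w N)),
      ∀ ν : ℝ, IsLocallyStarLike G (Δ N) (δ N) ν →
      ∀ (Ω : Type*) [MeasurableSpace Ω] (P : Measure Ω) [IsProbabilityMeasure P] (θ : Ω → Ω)
        (φ : Fin N → ℕ → Ω → Circ → Circ) (h : Ω → Circ → Circ → ℝ) (m₀ : Measure Circ)
        (α lam : ℝ),
        MeasurePreserving θ P P →
        (∀ i, IsRDS θ (φ i)) →
        IIDNodeMaps P θ φ →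
        (∀ i, IsUniqueStationary P (φ i 1) m₀) →
        IIDCoupling P θ h →
        0 < α → lam ∈ Set.Ioo (0 : ℝ) 1 →
        (∀ i ω x y, dist (φ i 1 ω x) (φ i 1 ω y) ≤ lam * dist x y) →
      (∀ i, m₀ = P.map (codingMap θ (φ i 1))) ∧
      ∀ᵐ ω ∂P, BddAbove (Set.range fun t : ℕ => normC4 (h (θ^[t] ω))) →
      ∀ x : Fin N → Circ,
        (∀ j ∈ lowDegreeNodes G (δ N), ∀ t : ℕ,
          dist (networkOrbit G α θ φ h t ω x j) (φ j t ω (x j)) ≤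
            (1 - lam)⁻¹ * (α * (largestDegree G : ℝ)⁻¹ * (δ N : ℝ) * supC0 θ h ω)) ∧
        ∀ ε : ℝ,
          max (α * (Δ N : ℝ) ^ (-(1 / 2) : ℝ))
            (4 * α ^ 2 * (δ N : ℝ) * (largestDegree G : ℝ)⁻¹ * (1 - lam)⁻¹ *
              supC0 θ h ω * supLip θ h ω) ≤ ε →
          ∀ i ∈ hubs G (Δ N),
            AdmitsReduction G α θ φ h
              (α * (starIndex G (δ N) i * (deg G i : ℝ) / (largestDegree G : ℝ))) m₀ i ω x
              (ε + α * (1 - ν) * supC0 θ h ω)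
              (4 * ((hubs G (Δ N)).card : ℝ) * D α ε (supC4 θ h ω) *
                Real.exp (-(ν * (Δ N : ℝ) * ε ^ 2 * (α ^ 2)⁻¹ * (450 / supC4 θ h ω ^ 2)))) := by
  refine ⟨1, 1, fun α ε H => α * ε⁻¹ * H, one_pos, le_rfl, fun α ε H _ _ _ => by simp, ?_⟩
  intro β lamHub lamLdn m w Δ δ hreg N
  refine ae_of_all _ fun G ν hstar Ω _ P _ θ φ h m₀ α lam hθ hφ hI hm hh hα hlam hf => ?_
  rcases isEmpty_or_nonempty (Fin N) with _ | ⟨⟨i₀⟩⟩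
  · exact ⟨isEmptyElim, ae_of_all _ fun ω _ x => ⟨isEmptyElim, fun ε _ => isEmptyElim⟩⟩
  have : IsProbabilityMeasure m₀ := (hm i₀).1
  have hΔ := hreg.hubScale_pos N
  obtain ⟨hcoding, hω⟩ := mainTheorem9_general (K := ⟨lam, hlam.1.le⟩) hΔ hstar hθ hφ hI.indep
    (fun i => (hm i).2.1) hh.isC4 hα hlam.2 fun i ω => .of_dist_le_mul (hf i ω)
  refine ⟨hcoding, hω.mono fun ω hω hb x => ⟨(hω hb x).1, fun ε hε => (hω hb x).2 ε ?_ ?_⟩⟩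
  · exact lt_of_lt_of_le (by positivity) ((le_max_left _ _).trans hε)
  · exact (le_max_right _ _).trans hε
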